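/- Let $X$ be a complex Banach space and let $B(X)$ be the algebra of bounded linear operators on $X$, with identity $I$. A nest on $X$ is a set $\mathcal N$ of closed subspaces of $X$ that contains $\{0\}$ and $X$, is totally ordered by inclusion, and contains the intersection and the closed linear span of the union of every family of its members; it is non-trivial if $\mathcal N\neq\{\{0\},X\}$. Put $\operatorname{Alg}\mathcal N=\{T\in B(X): TN\subseteq N\text{ for all }N\in\mathcal N\}$. Write $[a,b]=ab-ba$, and define the $(n-1)$-th commutators by $p_1(x_1)=x_1$ and $p_{n}(x_1,\dots,x_{n})=[p_{n-1}(x_1,\dots,x_{n-1}),x_{n}]$ for $n\ge 2$. For $n\ge 2$, a linear map $L:\operatorname{Alg}\mathcal N\to B(X)$ is a Lie $n$-derivation if $$L(p_n(A_1,\dots,A_n))=\sum_{k=1}^n p_n(A_1,\dots,A_{k-1},L(A_k),A_{k+1},\dots,A_n)\qquad\text{for all }A_1,\dots,A_n\in\operatorname{Alg}\mathcal N,$$ and a linear map $D:\operatorname{Alg}\mathcal N\to B(X)$ is an (associative) derivation if $D(AB)=D(A)B+A\,D(B)$ for all $A,B\in\operatorname{Alg}\mathcal N$. **Theorem.** Let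 $\mathcal N$ be a non-trivial nest on a complex Banach space $X$, let $n\ge 2$, and let $L:\operatorname{Alg}\mathcal N\to B(X)$ be a linear map. Then $L$ is a Lie $n$-derivation if and only if there exist a derivation $D:\operatorname{Alg}\mathcal N\to B(X)$ and a linear map $H:\operatorname{Alg}\mathcal N\to\mathbb C I$ with $H(p_n(A_1,\dots,A_n))=0$ for all $A_1,\dots,A_n\in\operatorname{Alg}\mathcal N$ such that $L=D+H$. Moreover, if $L$ is continuous in the operator norm, then in every such decomposition $L=D+H$ both $D$ and $H$ are continuous. -/

import Mathlib

namespace NestLie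

/-- A nest on `X`: a chain of closed subspaces containing `{0}` and `X` and closed under arbitrary
intersections and under closed linear spans of arbitrary unions. -/
structure IsNest {X : Type*} [NormedAddCommGroup X] [NormedSpace ℂ X]
    (𝒩 : Set (Submodule ℂ X)) : Prop where
  isClosed : ∀ N ∈ 𝒩, IsClosed (N : Set X)
  bot_mem : ⊥ ∈ 𝒩
  top_mem : ⊤ ∈ 𝒩
  total : ∀ N₁ ∈ 𝒩, ∀ N₂ ∈ 𝒩, N₁ ≤ N₂ ∨ N₂ ≤ N₁
  sInf_mem : ∀ S ⊆ 𝒩, sInf S ∈ 𝒩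
  closure_sSup_mem : ∀ S ⊆ 𝒩, (sSup S).topologicalClosure ∈ 𝒩

/-- `Alg 𝒩`: the algebra of the bounded operators that leave every member of `𝒩` invariant. -/
def nestAlg {X : Type*} [NormedAddCommGroup X] [NormedSpace ℂ X]
    (𝒩 : Set (Submodule ℂ X)) : Subalgebra ℂ (X →L[ℂ] X) where
  carrier := {T | ∀ N ∈ 𝒩, ∀ x ∈ N, T x ∈ N}
  mul_mem' := fun {S T} hS hT N hN x hx => hS N hN (T x) (hT N hN x hx)
  add_mem' := fun {_ _} hS hT N hN x hx => N.add_mem (hS N hN x hx) (hT N hN x hx)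
  algebraMap_mem' := fun c N _ x hx => by
    simpa [Algebra.algebraMap_eq_smul_one] using N.smul_mem c hx

/-- The `(n-1)`-th commutator `p n (x₁, …, xₙ)`: `p 1 x₁ = x₁` and
`p (n+1) (x₁, …, xₙ₊₁) = [p n (x₁, …, xₙ), xₙ₊₁]`, where `[a, b] = a * b - b * a`
(the value for `n = 0` is irrelevant). -/
def p {R : Type*} [Ring R] : (n : ℕ) → (Fin n → R) → R
  | 0, _ => 0
  | 1, x => x 0
  | n + 2, x => ⁅p (n + 1) (Fin.init x), x (Fin.last (n + 1))⁆

/-- An associative derivation from a subalgebra `𝒜` of `B` into `B`, where `B` is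
regarded as an `𝒜`-bimodule by multiplication. -/
def IsDerivation {B : Type*} [Ring B] [Algebra ℂ B] {𝒜 : Subalgebra ℂ B}
    (D : 𝒜 →ₗ[ℂ] B) : Prop :=
  ∀ x y : 𝒜, D (x * y) = D x * (y : B) + (x : B) * D y

/-- A Lie `n`-derivation from a subalgebra `𝒜` of `B` into `B`: in the `k`-th summand on the right,
the `k`-th argument `x k` of `p n` is replaced by `L (x k)`. -/
def IsLieDerivation {B : Type*} [Ring B] [Algebra ℂ B] {𝒜 : Subalgebra ℂ B}
    (n : ℕ) (L : 𝒜 →ₗ[ℂ] B) : Prop :=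
  ∀ x : Fin n → 𝒜,
    L (p n x) = ∑ k : Fin n, p n (Function.update (fun i => (x i : B)) k (L (x k)))

/-- `L = D + H` where `D` is an associative derivation and `H` is a linear map into `ℂ 1` that
vanishes on every `(n-1)`-th commutator of elements of `𝒜`. -/
structure IsStandardForm {B : Type*} [Ring B] [Algebra ℂ B] {𝒜 : Subalgebra ℂ B}
    (n : ℕ) (L D H : 𝒜 →ₗ[ℂ] B) : Prop where
  derivation : IsDerivation D
  scalar : ∀ x : 𝒜, ∃ c : ℂ, H x = c • (1 : B)
  vanish : ∀ x : Fin n → 𝒜, H (p n x) = 0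
  eq_add : L = D + H

end NestLie

/-!
A Lie `n`-derivation `L` makes `a ↦ a + ε L a` preserve `p n`. An operator that commutes with
`nestAlg 𝒩` up to scalars is a scalar, so `L` turns every relation `∑ [aᵢ, bᵢ] = 0` into a scalar.

If the proper members of the nest do not span a dense subspace, there is a functional `f ≠ 0` such
that `nestAlg 𝒩` contains all the operators `f ⊗ u : v ↦ f v • u`. Fix an idempotent `f ⊗ e`. After
subtracting a commutator `[σ, ·]`, the map `L` is scalar on `f ⊗ e`, kills `f ⊗ u` for `u` in the
kernel of `f`, and is therefore scalar everywhere.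

Otherwise `X` is infinite-dimensional, and a functional `ψ` on the operators with `ψ 1 = 1` that
vanishes on the operators of finite rank allows us to assume `ψ ∘ L = 0`, which makes the scalars
above vanish for the relations used here. For `x` in a proper member `M`, a functional `f` that
annihilates a larger proper member, a functional `g` that annihilates `M` and a vector `y` with
`g y = 1`, the relation `[A, f ⊗ x] - [g ⊗ A x, f ⊗ y] + [g ⊗ x, (f ∘ A) ⊗ y] = 0` yields
`L A = [σ, A] + k A + χ A` on `M`. The scalars `k` and `χ A` do not depend on `M`, so `L` is the
sum of a derivation, of `k` times the inclusion and of a scalar map, and the identity for `p n`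
allows `k ≠ 0` only if `nestAlg 𝒩` consists of scalars.

For the continuity, apply a continuous functional that vanishes at `1`, but not at some `b` in
`nestAlg 𝒩`, to `D (a * b) = D a * b + a * D b`: this expresses the scalar of `H a` through `L`.
-/

namespace NestLie

open TrivSqZeroExt
open scoped DualNumber

attribute [local instance] LieRing.ofAssociativeRing

/-! ### Lie derivations and dual numbers -/

section IteratedCommutator

variable {R S : Type*} [Ring R] [Ring S]

/-- The left-normed commutator `[…[[a, l₁], l₂], …, lₘ]`, that is, `p (m + 1) (a, l₁, …, lₘ)`. Lists
make it possible to concatenate arguments. -/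
def iterLie (a : R) (l : List R) : R :=
  l.foldl (fun x y => ⁅x, y⁆) a

theorem iterLie_nil (a : R) : iterLie a [] = a := rfl

theorem iterLie_cons (a b : R) (l : List R) : iterLie a (b :: l) = iterLie ⁅a, b⁆ l := rfl

theorem iterLie_append (a : R) (l m : List R) : iterLie a (l ++ m) = iterLie (iterLie a l) m :=
  List.foldl_append

theorem p_succ_eq_iterLie (n : ℕ) (x : Fin (n + 1) → R) :
    p (n + 1) x = iterLie (x 0) (List.ofFn (Fin.tail x)) := by
  induction n with
  | zero => rfl
  | succ n ih =>
    rw [p, ih, List.ofFn_succ', List.concat_eq_append, iterLie_append]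
    rfl

theorem iterLie_sum {ι : Type*} (s : Finset ι) (a : ι → R) (l : List R) :
    iterLie (∑ i ∈ s, a i) l = ∑ i ∈ s, iterLie (a i) l := by
  induction l generalizing a with
  | nil => rfl
  | cons b l ih => simp only [iterLie_cons, sum_lie, ih]

theorem iterLie_zero (l : List R) : iterLie 0 l = 0 :=
  iterLie_sum ∅ (fun _ : Empty => (0 : R)) l

theorem map_p (φ : R →+* S) (n : ℕ) (x : Fin n → R) : φ (p n x) = p n (φ ∘ x) := by
  induction n with
  | zero => exact map_zero φ
  | succ n ih =>
    obtain _ | n := n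
    · rfl
    · simp only [p, Ring.lie_def, map_sub, map_mul, ih]
      rfl

theorem p_eq_zero_of_central {n : ℕ} (hn : 2 ≤ n) (x : Fin n → R) (k : Fin n)
    (hk : ∀ b : R, ⁅x k, b⁆ = 0) : p n x = 0 := by
  induction n, hn using Nat.le_induction with
  | base =>
    change ⁅x 0, x 1⁆ = 0
    obtain rfl | rfl : k = 0 ∨ k = 1 := by omega
    · exact hk _
    · rw [← lie_skew, hk, neg_zero]
  | succ n hn ih =>
    obtain ⟨n, rfl⟩ := Nat.exists_eq_add_of_le' (one_le_two.trans hn)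
    rw [p]
    induction k using Fin.lastCases with
    | last => rw [← lie_skew, hk, neg_zero]
    | cast j => rw [ih (Fin.init x) j hk, zero_lie]

variable (R) in
/-- `p n` as a multilinear map in its `n` arguments. -/
def pMultilinear [Algebra ℂ R] : (n : ℕ) → MultilinearMap ℂ (fun _ : Fin n => R) R
  | 0 => 0
  | 1 => MultilinearMap.ofSubsingleton ℂ R R 0 LinearMap.id
  | n + 2 =>
    ((LieModule.toEnd ℂ R R : R →ₗ[ℂ] R →ₗ[ℂ] R).compMultilinearMap
      (pMultilinear (n + 1))).uncurryRight

theorem pMultilinear_apply [Algebra ℂ R] (n : ℕ) (x : Fin n → R) : pMultilinear R n x = p n x := by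
  induction n with
  | zero => rfl
  | succ n ih =>
    obtain _ | n := n
    · rfl
    · rw [p, ← ih]
      rfl

theorem fst_lie (x y : R[ε]) : fst ⁅x, y⁆ = ⁅fst x, fst y⁆ := rfl

theorem snd_lie (x y : R[ε]) : snd ⁅x, y⁆ = ⁅snd x, fst y⁆ + ⁅fst x, snd y⁆ := by
  simp only [Ring.lie_def, snd_sub, snd_mul, smul_eq_mul, op_smul_eq_mul]
  abel

theorem iterLie_inr (w : R) (l : List R[ε]) :
    iterLie (inr w : R[ε]) l = inr (iterLie w (l.map fst)) := by
  induction l generalizing w with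
  | nil => rfl
  | cons x l ih =>
    have : ⁅(inr w : R[ε]), x⁆ = inr ⁅w, fst x⁆ := by ext <;> simp [fst_lie, snd_lie]
    rw [iterLie_cons, this, ih, List.map_cons, iterLie_cons]

theorem fst_p (n : ℕ) (x : Fin n → R[ε]) : fst (p n x) = p n fun i => fst (x i) :=
  map_p (fstHom ℤ R R).toRingHom n x

theorem snd_p (n : ℕ) (x : Fin n → R[ε]) :
    snd (p n x) = ∑ k, p n (Function.update (fun i => fst (x i)) k (snd (x k))) := by
  induction n with
  | zero => rfl
  | succ n ih =>
    obtain _ | n := n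
    · simp [p]
    · have hcast (j : Fin (n + 1)) : Function.update (fun i => fst (x i)) j.castSucc
          (snd (x j.castSucc)) (Fin.last (n + 1)) = fst (x (Fin.last (n + 1))) :=
        Function.update_of_ne (Fin.castSucc_ne_last j).symm _ _
      rw [Fin.sum_univ_castSucc]
      simp only [p, Fin.init_update_castSucc, Fin.init_update_last, Function.update_self, hcast,
        ← sum_lie, snd_lie, fst_p, ih]
      rfl

end IteratedCommutator

section LieDerivation

variable {B : Type*} [Ring B] [Algebra ℂ B] {𝒜 : Subalgebra ℂ B} {L L' D H : 𝒜 →ₗ[ℂ] B} {n : ℕ}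

theorem coe_lie (a b : 𝒜) : ((⁅a, b⁆ : 𝒜) : B) = ⁅(a : B), (b : B)⁆ := rfl

theorem coe_p (x : Fin n → 𝒜) : (p n x : 𝒜) = p n fun i => (x i : B) :=
  map_p 𝒜.val.toRingHom n x

/-- The first-order perturbation `a ↦ a + ε L a` of the inclusion of `𝒜` in `B`, with values in the
dual numbers over `B`. It preserves products, or commutators, precisely if `L` satisfies the
corresponding product rule. -/
def perturbation (L : 𝒜 →ₗ[ℂ] B) : 𝒜 →ₗ[ℂ] B[ε] where
  toFun a := (a, L a)
  map_add' a b := congrArg (Prod.mk _) (map_add L a b)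
  map_smul' c a := congrArg (Prod.mk _) (map_smul L c a)

theorem fst_perturbation (a : 𝒜) : fst (perturbation L a) = a := rfl

theorem snd_perturbation (a : 𝒜) : snd (perturbation L a) = L a := rfl

theorem isLieDerivation_iff_perturbation :
    IsLieDerivation n L ↔ ∀ x : Fin n → 𝒜, perturbation L (p n x) = p n (perturbation L ∘ x) := by
  refine forall_congr' fun x => ?_
  simp only [TrivSqZeroExt.ext_iff, fst_p, snd_p, Function.comp_apply, fst_perturbation,
    snd_perturbation, coe_p, true_and]

theorem IsDerivation.perturbation_mul (hD : IsDerivation D) (a b : 𝒜) :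
    perturbation D (a * b) = perturbation D a * perturbation D b := by
  ext
  · rfl
  · simp only [snd_mul, fst_perturbation, snd_perturbation, hD a b, smul_eq_mul, op_smul_eq_mul]
    abel

theorem IsDerivation.map_one (hD : IsDerivation D) : D 1 = 0 := by
  simpa using hD 1 1

theorem IsDerivation.isLieDerivation (hD : IsDerivation D) : IsLieDerivation n D :=
  let φ : 𝒜 →+* B[ε] :=
    { (perturbation D).toAddMonoidHom with
      map_one' := TrivSqZeroExt.ext rfl hD.map_one
      map_mul' := hD.perturbation_mul }
  isLieDerivation_iff_perturbation.2 (map_p φ n)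

theorem IsLieDerivation.perturbation_iterLie (hL : IsLieDerivation n L) (a : 𝒜) {l : List 𝒜}
    (hl : l.length + 1 = n) :
    perturbation L (iterLie a l) = iterLie (perturbation L a) (l.map (perturbation L)) := by
  subst hl
  have h := isLieDerivation_iff_perturbation.1 hL (Fin.cons a l.get)
  rw [p_succ_eq_iterLie, p_succ_eq_iterLie] at h
  simpa [Fin.tail_def, Function.comp_def, ← List.map_ofFn] using h

theorem IsLieDerivation.sub (hL : IsLieDerivation n L) (hL' : IsLieDerivation n L') :
    IsLieDerivation n (L - L') := fun x => by
  rw [LinearMap.sub_apply, hL x, hL' x, ← Finset.sum_sub_distrib]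
  simp only [← pMultilinear_apply, LinearMap.sub_apply, MultilinearMap.map_update_sub]

theorem IsLieDerivation.add (hL : IsLieDerivation n L) (hL' : IsLieDerivation n L') :
    IsLieDerivation n (L + L') := fun x => by
  rw [LinearMap.add_apply, hL x, hL' x, ← Finset.sum_add_distrib]
  simp only [← pMultilinear_apply, LinearMap.add_apply, MultilinearMap.map_update_add]

theorem smul_one_lie (c : ℂ) (b : B) : ⁅c • (1 : B), b⁆ = 0 := by
  simp [Ring.lie_def]

theorem lie_smul_one (c : ℂ) (b : B) : ⁅b, c • (1 : B)⁆ = 0 := by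
  rw [← lie_skew, smul_one_lie, neg_zero]

theorem isLieDerivation_iff_of_scalar (hn : 2 ≤ n) (hH : ∀ x, ∃ c : ℂ, H x = c • (1 : B)) :
    IsLieDerivation n H ↔ ∀ x : Fin n → 𝒜, H (p n x) = 0 := by
  refine forall_congr' fun x => ?_
  rw [Finset.sum_eq_zero fun k _ => p_eq_zero_of_central hn _ k fun b => ?_]
  obtain ⟨c, hc⟩ := hH (x k)
  rw [Function.update_self, hc, smul_one_lie]

theorem IsStandardForm.isLieDerivation (hn : 2 ≤ n) (h : IsStandardForm n L D H) :
    IsLieDerivation n L :=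
  h.eq_add ▸ h.derivation.isLieDerivation.add
    ((isLieDerivation_iff_of_scalar hn h.scalar).2 h.vanish)

theorem IsLieDerivation.isStandardForm (hn : 2 ≤ n) (hL : IsLieDerivation n L)
    (hD : IsDerivation D) (hH : ∀ x, ∃ c : ℂ, (L - D) x = c • (1 : B)) :
    IsStandardForm n L D (L - D) where
  derivation := hD
  scalar := hH
  vanish := (isLieDerivation_iff_of_scalar hn hH).1 (hL.sub hD.isLieDerivation)
  eq_add := (add_sub_cancel D L).symm

end LieDerivation

section Centroid

variable {B : Type*} [Ring B] [Algebra ℂ B] {𝒜 : Subalgebra ℂ B} {L H : 𝒜 →ₗ[ℂ] B} {n : ℕ}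

/-- Elements of `B` that commute with `𝒜` up to scalars are scalar. -/
def ScalarOfLieScalar (𝒜 : Subalgebra ℂ B) : Prop :=
  ∀ w : B, (∀ a : 𝒜, ∃ c : ℂ, ⁅w, (a : B)⁆ = c • (1 : B)) → ∃ c : ℂ, w = c • (1 : B)

theorem ScalarOfLieScalar.of_iterLie (h𝒜 : ScalarOfLieScalar 𝒜) (m : ℕ) (w : B)
    (hw : ∀ l : List 𝒜, l.length = m → ∃ c : ℂ, iterLie w (l.map (↑)) = c • (1 : B)) :
    ∃ c : ℂ, w = c • (1 : B) := by
  induction m generalizing w with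
  | zero => exact hw [] rfl
  | succ m ih =>
    exact h𝒜 w fun a => ih _ fun l hl => hw (a :: l) (congrArg (· + 1) hl)

/-- Every relation `∑ [aᵢ, bᵢ] = 0` in `𝒜` is turned by the product rule for `L` into an element of
`ℂ 1`. -/
def RespectsCommutatorRelations (L : 𝒜 →ₗ[ℂ] B) : Prop :=
  ∀ (m : ℕ) (a b : Fin m → 𝒜), ∑ i, ⁅a i, b i⁆ = 0 →
    ∃ c : ℂ, ∑ i, (⁅L (a i), (b i : B)⁆ + ⁅(a i : B), L (b i)⁆) = c • (1 : B)

theorem IsLieDerivation.respectsCommutatorRelations (h𝒜 : ScalarOfLieScalar 𝒜) (hn : 2 ≤ n)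
    (hL : IsLieDerivation n L) : RespectsCommutatorRelations L := by
  intro m a b hab
  refine h𝒜.of_iterLie (n - 2) _ fun l hl => ⟨0, ?_⟩
  set φ := perturbation L
  set w := ∑ i, (⁅L (a i), (b i : B)⁆ + ⁅(a i : B), L (b i)⁆)
  have hw : ∑ i, ⁅φ (a i), φ (b i)⁆ = inr w := by
    have hab' : ∑ i, ⁅(a i : B), (b i : B)⁆ = 0 :=
      (map_sum 𝒜.val _ _).symm.trans (congrArg 𝒜.val hab)
    ext
    · rw [fst_sum]
      exact hab'
    · simp only [snd_sum, snd_lie]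
      rfl
  have h0 : iterLie (inr w) (l.map φ) = 0 :=
    calc iterLie (inr w) (l.map φ) = ∑ i, iterLie (φ (a i)) ((b i :: l).map φ) := by
          rw [← hw, iterLie_sum]; rfl
      _ = φ (iterLie (∑ i, ⁅a i, b i⁆) l) := by
          rw [iterLie_sum, map_sum]
          exact Finset.sum_congr rfl fun i _ =>
            (hL.perturbation_iterLie (a i) (by simp only [List.length_cons]; omega)).symm
      _ = 0 := by rw [hab, iterLie_zero, map_zero]
  rw [iterLie_inr, List.map_map] at h0
  exact (congrArg snd h0).trans (zero_smul ℂ 1).symm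

/-- `L` is, up to maps with values in `ℂ 1`, the sum of a derivation and a multiple of the inclusion
of `𝒜` in `B`. -/
def IsDerivationModCentroid (L : 𝒜 →ₗ[ℂ] B) : Prop :=
  ∃ D : 𝒜 →ₗ[ℂ] B, IsDerivation D ∧ ∃ k : ℂ, ∀ a, ∃ c : ℂ, L a = D a + k • (a : B) + c • (1 : B)

theorem RespectsCommutatorRelations.sub_scalar (hL : RespectsCommutatorRelations L)
    (hH : ∀ a, ∃ c : ℂ, H a = c • (1 : B)) : RespectsCommutatorRelations (L - H) := by
  have hHl (a b : 𝒜) : ⁅H a, (b : B)⁆ = 0 := by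
    obtain ⟨c, hc⟩ := hH a
    rw [hc, smul_one_lie]
  have hHr (a b : 𝒜) : ⁅(a : B), H b⁆ = 0 := by rw [← lie_skew, hHl, neg_zero]
  simpa only [RespectsCommutatorRelations, LinearMap.sub_apply, sub_lie, lie_sub, hHl, hHr,
    sub_zero] using hL

theorem IsDerivationModCentroid.of_sub_scalar (hL : IsDerivationModCentroid (L - H))
    (hH : ∀ a, ∃ c : ℂ, H a = c • (1 : B)) : IsDerivationModCentroid L := by
  obtain ⟨D, hD, k, h⟩ := hL
  refine ⟨D, hD, k, fun a => ?_⟩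
  obtain ⟨c, hc⟩ := h a
  obtain ⟨d, hd⟩ := hH a
  refine ⟨c + d, ?_⟩
  rw [← sub_add_cancel L H, LinearMap.add_apply, hc, hd, add_smul, add_assoc]

theorem IsLieDerivation.smul_p_eq_of_centroid (hn : 2 ≤ n) (hL : IsLieDerivation n L) {k : ℂ}
    {c : 𝒜 → ℂ} (hk : ∀ a, L a = k • (a : B) + c a • (1 : B)) (x : Fin n → 𝒜) :
    ((n - 1) * k) • ((p n x : 𝒜) : B) = c (p n x) • (1 : B) := by
  have hupdate (i : Fin n) :
      p n (Function.update (fun j => (x j : B)) i (L (x i))) = k • ((p n x : 𝒜) : B) := by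
    have h1 : p n (Function.update (fun j => (x j : B)) i 1) = 0 :=
      p_eq_zero_of_central hn _ i fun b => by simp [Ring.lie_def]
    rw [← pMultilinear_apply] at h1
    rw [hk, coe_p, ← pMultilinear_apply, ← pMultilinear_apply, MultilinearMap.map_update_add,
      MultilinearMap.map_update_smul, MultilinearMap.map_update_smul, h1, smul_zero, add_zero,
      Function.update_eq_self]
  have h := hL x
  simp only [hk (p n x), hupdate, Finset.sum_const, Finset.card_univ, Fintype.card_fin] at h
  rw [sub_mul, sub_smul, one_mul, mul_smul, Nat.cast_smul_eq_nsmul, ← h, add_sub_cancel_left]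

theorem ScalarOfLieScalar.of_p (h𝒜 : ScalarOfLieScalar 𝒜) (hn : 1 ≤ n)
    (hp : ∀ x : Fin n → 𝒜, ∃ c : ℂ, ((p n x : 𝒜) : B) = c • (1 : B)) (a : 𝒜) :
    ∃ c : ℂ, (a : B) = c • (1 : B) := by
  refine h𝒜.of_iterLie (n - 1) a fun l hl => ?_
  obtain rfl : l.length + 1 = n := by omega
  obtain ⟨c, hc⟩ := hp (Fin.cons a l.get)
  rw [coe_p, p_succ_eq_iterLie] at hc
  exact ⟨c, by simpa [Fin.tail_def, ← Function.comp_def, ← List.map_ofFn] using hc⟩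

theorem IsLieDerivation.exists_isStandardForm (h𝒜 : ScalarOfLieScalar 𝒜) (hn : 2 ≤ n)
    (hL : IsLieDerivation n L) (hL' : IsDerivationModCentroid L) :
    ∃ D H : 𝒜 →ₗ[ℂ] B, IsStandardForm n L D H := by
  obtain ⟨D, hD, k, hk⟩ := hL'
  choose c hc using hk
  have hE (a : 𝒜) : (L - D) a = k • (a : B) + c a • (1 : B) := by
    rw [LinearMap.sub_apply, hc]
    abel
  refine ⟨D, L - D, hL.isStandardForm hn hD fun a => ?_⟩
  rcases eq_or_ne k 0 with rfl | hk0
  · exact ⟨c a, by rw [hE, zero_smul, zero_add]⟩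
  have hnk : ((n - 1) * k : ℂ) ≠ 0 :=
    mul_ne_zero (sub_ne_zero.2 (by exact_mod_cast (by omega : n ≠ 1))) hk0
  obtain ⟨d, hd⟩ := h𝒜.of_p (one_le_two.trans hn) (fun x => ⟨((n - 1) * k)⁻¹ * c (p n x), by
    rw [mul_smul, ← (hL.sub hD.isLieDerivation).smul_p_eq_of_centroid hn hE, inv_smul_smul₀ hnk]⟩) a
  exact ⟨k * d + c a, by rw [hE, hd, smul_smul, add_smul]⟩

end Centroid

/-! ### Scalar commutants and chains of closed subspaces -/

theorem lie_mul {R : Type*} [Ring R] (w a b : R) : ⁅w, a * b⁆ = ⁅w, a⁆ * b + a * ⁅w, b⁆ := by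
  simp only [Ring.lie_def]
  noncomm_ring

theorem lie_eq_zero_of_forall_lie_scalar {B : Type*} [Ring B] [Algebra ℂ B] {𝒜 : Subalgebra ℂ B}
    {T : 𝒜} (hT : (T : B) ≠ 0) (hTT : (T : B) * T = 0) {w : B}
    (hw : ∀ a : 𝒜, ∃ c : ℂ, ⁅w, (a : B)⁆ = c • (1 : B)) (a : 𝒜) : ⁅w, (a : B)⁆ = 0 := by
  have hwT : ⁅w, (T : B)⁆ = 0 := by
    obtain ⟨s, hs⟩ := hw T
    have h : (2 * s) • (T : B) = 0 := by
      have := lie_mul w (T : B) T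
      rw [hTT, lie_zero, hs, smul_mul_assoc, one_mul, mul_smul_comm, mul_one, ← two_smul ℂ,
        smul_smul] at this
      exact this.symm
    rw [hs, ((mul_eq_zero_iff_left two_ne_zero).1 ((smul_eq_zero_iff_left hT).1 h)), zero_smul]
  obtain ⟨s, hs⟩ := hw a
  obtain ⟨t, ht⟩ := hw (a * T)
  have hst : s • (T : B) = t • (1 : B) := by
    rw [← ht, Subalgebra.coe_mul, lie_mul, hwT, hs, smul_mul_assoc, one_mul, mul_zero, add_zero]
  have ht0 : t • (T : B) = 0 := by
    rw [← one_mul (T : B), ← smul_mul_assoc, ← hst, smul_mul_assoc, hTT, smul_zero]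
  rw [(smul_eq_zero_iff_left hT).1 ht0, zero_smul] at hst
  rw [hs, (smul_eq_zero_iff_left hT).1 hst, zero_smul]

theorem exists_eq_smul_of_forall_apply {K V W : Type*} [Field K] [AddCommGroup V] [Module K V]
    [AddCommGroup W] [Module K W] {F G : V →ₗ[K] W} (h : ∀ y, ∃ c : K, F y = c • G y) :
    ∃ c : K, F = c • G := by
  by_cases hG : G = 0
  · refine ⟨0, LinearMap.ext fun y => ?_⟩
    obtain ⟨c, hc⟩ := h y
    simp [hc, hG]
  obtain ⟨y₀, hy₀⟩ := DFunLike.ne_iff.1 hG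
  obtain ⟨c₀, hc₀⟩ := h y₀
  refine ⟨c₀, LinearMap.ext fun y => sub_eq_zero.1 ?_⟩
  set F' := F - c₀ • G
  have hF'y₀ : F' y₀ = 0 := sub_eq_zero.2 hc₀
  have hF' (z : V) : ∃ c : K, F' z = c • G z := by
    obtain ⟨c, hc⟩ := h z
    exact ⟨c - c₀, by rw [sub_smul, ← hc]; rfl⟩
  change F' y = 0
  by_cases hy : ∃ t : K, G y = t • G y₀
  · obtain ⟨t, ht⟩ := hy
    obtain ⟨c, hc⟩ := hF' (y - t • y₀)
    simpa [hF'y₀, ht] using hc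
  · obtain ⟨a, ha⟩ := hF' y
    obtain ⟨b, hb⟩ := hF' (y + y₀)
    have hab : (a - b) • G y = b • G y₀ := by
      rw [map_add, hF'y₀, add_zero, ha, map_add, smul_add] at hb
      rw [sub_smul, hb, add_sub_cancel_left]
    have heq : a = b := by
      by_contra hne
      exact hy ⟨(a - b)⁻¹ * b, by rw [mul_smul, ← hab, inv_smul_smul₀ (sub_ne_zero.2 hne)]⟩
    rw [heq, sub_self, zero_smul] at hab
    rw [ha, heq, (smul_eq_zero_iff_left hy₀).1 hab.symm, zero_smul]

section Operator

variable {X : Type*} [NormedAddCommGroup X] [NormedSpace ℂ X] {f : X →L[ℂ] ℂ}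

theorem lie_apply (S T : X →L[ℂ] X) (v : X) : ⁅S, T⁆ v = S (T v) - T (S v) := rfl

theorem smulRight_mul (f : X →L[ℂ] ℂ) (x : X) (S : X →L[ℂ] X) :
    f.smulRight x * S = (f.comp S).smulRight x := rfl

theorem mul_smulRight (f : X →L[ℂ] ℂ) (x : X) (S : X →L[ℂ] X) :
    S * f.smulRight x = f.smulRight (S x) := by
  ext; simp

theorem exists_mem_apply_eq_one {U : Submodule ℂ X} (hU : Dense (U : Set X)) (hf : f ≠ 0) :
    ∃ u ∈ U, f u = 1 := by
  obtain ⟨u, hu, hfu⟩ : ∃ u ∈ U, f u ≠ 0 := by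
    by_contra! h
    exact hf (ContinuousLinearMap.ext_on (hU.mono Submodule.subset_span) h)
  exact ⟨(f u)⁻¹ • u, U.smul_mem _ hu, by simp [hfu]⟩

theorem exists_apply_eq_one (hf : f ≠ 0) : ∃ z, f z = 1 := by
  obtain ⟨z, -, hz⟩ := exists_mem_apply_eq_one (U := ⊤) dense_univ hf
  exact ⟨z, hz⟩

theorem ne_zero_of_apply_eq_one {z : X} (hz : f z = 1) : f ≠ 0 := by
  rintro rfl
  exact zero_ne_one hz

theorem exists_annihilator {M : Submodule ℂ X} (hM : IsClosed (M : Set X)) {y : X} (hy : y ∉ M) :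
    ∃ f : X →L[ℂ] ℂ, (∀ x ∈ M, f x = 0) ∧ f y = 1 := by
  have : IsClosed (M : Set X) := hM
  obtain ⟨f, hf⟩ := SeparatingDual.exists_eq_one (R := ℂ) (x := M.mkQ y) (by simpa using hy)
  refine ⟨f.comp M.mkQL, fun x hx => ?_, hf⟩
  simpa using congrArg f ((Submodule.Quotient.mk_eq_zero M).2 hx)

theorem scalar_of_lie_smulRight_eq_zero {w : X →L[ℂ] X} {x₀ : X} (hx₀ : x₀ ≠ 0)
    (hd : Dense {y : X | ∃ f : X →L[ℂ] ℂ, f ≠ 0 ∧ ⁅w, f.smulRight y⁆ = 0 ∧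
      ⁅w, f.smulRight x₀⁆ = 0}) :
    ∃ c : ℂ, w = c • (1 : X →L[ℂ] X) := by
  have heigen {f : X →L[ℂ] ℂ} {z u : X} (hz : f z = 1) (hu : ⁅w, f.smulRight u⁆ = 0) :
      w u = f (w z) • u := by
    have := DFunLike.congr_fun hu z
    simpa [lie_apply, hz, sub_eq_zero] using this
  obtain ⟨φ, hφ⟩ := SeparatingDual.exists_eq_one (R := ℂ) hx₀
  refine ⟨φ (w x₀), ContinuousLinearMap.ext_on (hd.mono Submodule.subset_span) ?_⟩
  rintro y ⟨f, hf, hy, hx⟩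
  obtain ⟨z, hz⟩ := exists_apply_eq_one hf
  simp [heigen hz hy, heigen hz hx, hφ]

theorem scalarOfLieScalar_of_dense {𝒜 : Subalgebra ℂ (X →L[ℂ] X)} {T : 𝒜}
    (hT : (T : X →L[ℂ] X) ≠ 0) (hTT : (T : X →L[ℂ] X) * T = 0) {x₀ : X} (hx₀ : x₀ ≠ 0)
    (hd : Dense {y : X | ∃ f : X →L[ℂ] ℂ, f ≠ 0 ∧ f.smulRight y ∈ 𝒜 ∧ f.smulRight x₀ ∈ 𝒜}) :
    ScalarOfLieScalar 𝒜 := fun w hw => by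
  have hcomm (S : X →L[ℂ] X) (hS : S ∈ 𝒜) : ⁅w, S⁆ = 0 :=
    lie_eq_zero_of_forall_lie_scalar hT hTT hw ⟨S, hS⟩
  refine scalar_of_lie_smulRight_eq_zero hx₀ (hd.mono ?_)
  rintro y ⟨f, hf, hy, hx⟩
  exact ⟨f, hf, hcomm _ hy, hcomm _ hx⟩

end Operator

section ClosedChain

variable {X : Type*} [NormedAddCommGroup X] [NormedSpace ℂ X] {𝒩 : Set (Submodule ℂ X)}

/-- A chain of closed subspaces: a nest without the completeness requirements. -/
structure IsClosedChain (𝒩 : Set (Submodule ℂ X)) : Prop where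
  isClosed : ∀ N ∈ 𝒩, IsClosed (N : Set X)
  total : ∀ N₁ ∈ 𝒩, ∀ N₂ ∈ 𝒩, N₁ ≤ N₂ ∨ N₂ ≤ N₁

theorem IsNest.isClosedChain (h𝒩 : IsNest 𝒩) : IsClosedChain 𝒩 :=
  ⟨h𝒩.isClosed, h𝒩.total⟩

theorem IsNest.exists_ne_bot_ne_top (h𝒩 : IsNest 𝒩) (hnontriv : 𝒩 ≠ {⊥, ⊤}) :
    ∃ N ∈ 𝒩, N ≠ ⊥ ∧ N ≠ ⊤ := by
  by_contra! h
  refine hnontriv (Set.Subset.antisymm (fun N hN => or_iff_not_imp_left.2 (h N hN)) ?_)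
  exact Set.pair_subset h𝒩.bot_mem h𝒩.top_mem

namespace IsClosedChain

variable (h𝒩 : IsClosedChain 𝒩) {M : Submodule ℂ X}
include h𝒩

theorem exists_annihilator (hM : M ∈ 𝒩) (hM' : M ≠ ⊤) :
    ∃ f : X →L[ℂ] ℂ, f ≠ 0 ∧ ∀ x ∈ M, f x = 0 := by
  obtain ⟨y, -, hy⟩ := SetLike.exists_of_lt hM'.lt_top
  obtain ⟨f, hf, hfy⟩ := NestLie.exists_annihilator (h𝒩.isClosed M hM) hy
  exact ⟨f, ne_zero_of_apply_eq_one hfy, hf⟩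

theorem smulRight_mem (hM : M ∈ 𝒩) {f : X →L[ℂ] ℂ} (hf : ∀ y ∈ M, f y = 0) {x : X} (hx : x ∈ M) :
    f.smulRight x ∈ nestAlg 𝒩 := by
  intro N hN v hv
  rcases h𝒩.total N hN M hM with h | h
  · simp [hf v (h hv)]
  · exact N.smul_mem _ (h hx)

end IsClosedChain

/-- The linear span of the proper members of a family of subspaces. -/
def properSpan (𝒩 : Set (Submodule ℂ X)) : Submodule ℂ X :=
  sSup {M ∈ 𝒩 | M ≠ ⊤}

theorem le_properSpan {N : Submodule ℂ X} (hN : N ∈ 𝒩) (hN' : N ≠ ⊤) : N ≤ properSpan 𝒩 :=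
  le_sSup (Set.mem_ofPred.2 ⟨hN, hN'⟩)

variable (𝒩) in
theorem dense_properSpan_or_exists_smulRight_mem :
    Dense (properSpan 𝒩 : Set X) ∨
      ∃ f : X →L[ℂ] ℂ, f ≠ 0 ∧ ∀ u, f.smulRight u ∈ nestAlg 𝒩 := by
  rw [Submodule.dense_iff_topologicalClosure_eq_top]
  refine or_iff_not_imp_left.2 fun h => ?_
  obtain ⟨z, -, hz⟩ := SetLike.exists_of_lt (Ne.lt_top h)
  obtain ⟨f, hf, hfz⟩ := exists_annihilator (Submodule.isClosed_topologicalClosure _) hz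
  refine ⟨f, ne_zero_of_apply_eq_one hfz, fun u N hN v hv => ?_⟩
  rcases eq_or_ne N ⊤ with rfl | hN'
  · exact Submodule.mem_top
  · simp [hf v (Submodule.le_topologicalClosure _ (le_properSpan hN hN' hv))]

namespace IsClosedChain

variable (h𝒩 : IsClosedChain 𝒩) {M N : Submodule ℂ X}
include h𝒩

theorem exists_ge_mem (hM : M ∈ 𝒩) (hM' : M ≠ ⊤) {y : X} (hy : y ∈ properSpan 𝒩) :
    ∃ N ∈ 𝒩, N ≠ ⊤ ∧ M ≤ N ∧ y ∈ N := by
  have hne : {M ∈ 𝒩 | M ≠ ⊤}.Nonempty := ⟨M, hM, hM'⟩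
  have hdir : DirectedOn (· ≤ ·) {M ∈ 𝒩 | M ≠ ⊤} := by
    rintro A ⟨hA, hA'⟩ B ⟨hB, hB'⟩
    rcases h𝒩.total A hA B hB with h | h
    exacts [⟨B, ⟨hB, hB'⟩, h, le_rfl⟩, ⟨A, ⟨hA, hA'⟩, le_rfl, h⟩]
  obtain ⟨N, ⟨hN, hN'⟩, hyN⟩ := (Submodule.mem_sSup_of_directed hne hdir).1 hy
  rcases h𝒩.total M hM N hN with h | h
  exacts [⟨N, hN, hN', h, hyN⟩, ⟨M, hM, hM', le_rfl, h hyN⟩]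

theorem exists_gt (hd : Dense (properSpan 𝒩 : Set X)) (hM : M ∈ 𝒩) (hM' : M ≠ ⊤) :
    ∃ N ∈ 𝒩, N ≠ ⊤ ∧ M < N := by
  by_contra! h
  have hle : properSpan 𝒩 ≤ M := sSup_le fun N hN =>
    (h𝒩.total N hN.1 M hM).elim id fun hMN => (hMN.eq_of_not_lt (h N hN.1 hN.2)).ge
  refine hM' (top_le_iff.1 ?_)
  rw [← Submodule.dense_iff_topologicalClosure_eq_top.1 hd]
  exact Submodule.topologicalClosure_minimal _ hle (h𝒩.isClosed M hM)

theorem not_finiteDimensional (hd : Dense (properSpan 𝒩 : Set X)) (hN : N ∈ 𝒩) (hN' : N ≠ ⊤) :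
    ¬FiniteDimensional ℂ X := fun _ => by
  obtain ⟨M, ⟨hM, hM'⟩, hmax⟩ :=
    (wellFounded_gt (α := Submodule ℂ X)).has_min {M ∈ 𝒩 | M ≠ ⊤} ⟨N, hN, hN'⟩
  obtain ⟨M', h, h', hlt⟩ := h𝒩.exists_gt hd hM hM'
  exact hmax M' ⟨h, h'⟩ hlt

theorem exists_sq_zero (hN : N ∈ 𝒩) (hN0 : N ≠ ⊥) (hN' : N ≠ ⊤) :
    ∃ T ∈ nestAlg 𝒩, T ≠ 0 ∧ T * T = 0 := by
  obtain ⟨x, hx, hx0⟩ := Submodule.exists_mem_ne_zero_of_ne_bot hN0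
  obtain ⟨f, hf0, hf⟩ := h𝒩.exists_annihilator hN hN'
  obtain ⟨z, hz⟩ := exists_apply_eq_one hf0
  refine ⟨f.smulRight x, h𝒩.smulRight_mem hN hf hx, fun h => hx0 ?_, ?_⟩
  · simpa [hz] using DFunLike.congr_fun h z
  · ext v
    simp [hf x hx]

theorem scalarOfLieScalar (hN : N ∈ 𝒩) (hN0 : N ≠ ⊥) (hN' : N ≠ ⊤) :
    ScalarOfLieScalar (nestAlg 𝒩) := by
  obtain ⟨T, hT, hT0, hTT⟩ := h𝒩.exists_sq_zero hN hN0 hN'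
  obtain ⟨x, hx, hx0⟩ := Submodule.exists_mem_ne_zero_of_ne_bot hN0
  refine scalarOfLieScalar_of_dense (T := ⟨T, hT⟩) hT0 hTT hx0 ?_
  rcases dense_properSpan_or_exists_smulRight_mem 𝒩 with hd | ⟨f, hf0, hf⟩
  · refine hd.mono fun y hy => ?_
    obtain ⟨M, hM, hM', hNM, hyM⟩ := h𝒩.exists_ge_mem hN hN' hy
    obtain ⟨f, hf0, hf⟩ := h𝒩.exists_annihilator hM hM'
    exact ⟨f, hf0, h𝒩.smulRight_mem hM hf hyM, h𝒩.smulRight_mem hM hf (hNM hx)⟩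
  · exact dense_univ.mono fun y _ => ⟨f, hf0, hf y, hf x⟩

end IsClosedChain

end ClosedChain

/-! ### Algebras containing all the rank-one operators with a given functional -/

section Idempotent

section Ring

variable {R : Type*} [Ring R] {q : R}

theorem lie_lie_idempotent (hq : q * q = q) (w : R) :
    ⁅⁅w, q⁆, q⁆ = w * q - 2 * (q * w * q) + q * w := by
  linear_combination (norm := skip) w * hq + hq * w
  simp only [Ring.lie_def]
  noncomm_ring

theorem lie_lie_lie_idempotent (hq : q * q = q) (w : R) : ⁅⁅⁅w, q⁆, q⁆, q⁆ = ⁅w, q⁆ := by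
  rw [lie_lie_idempotent hq]
  linear_combination (norm := skip) w * hq - hq * w - 2 * q * w * hq + 2 * hq * w * q
  simp only [Ring.lie_def]
  noncomm_ring

theorem idempotent_mul_lie_lie_mul_idempotent (hq : q * q = q) (w : R) :
    q * ⁅⁅w, q⁆, q⁆ * q = 0 := by
  rw [lie_lie_idempotent hq]
  linear_combination (norm := skip) q * w * hq + hq * w * q - 2 * hq * w * q * q - 2 * q * w * hq
  noncomm_ring

theorem iterLie_replicate_of_lie_lie_lie {x : R} (hx : ∀ w : R, ⁅⁅⁅w, x⁆, x⁆, x⁆ = ⁅w, x⁆) (w : R)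
    (m : ℕ) : iterLie w (List.replicate (2 * m + 1) x) = ⁅w, x⁆ := by
  induction m with
  | zero => rfl
  | succ m ih =>
    rw [mul_add_one, add_right_comm, List.replicate_add, iterLie_append, ih]
    exact hx w

end Ring

variable {B : Type*} [Ring B] [Algebra ℂ B] {𝒜 : Subalgebra ℂ B} {L : 𝒜 →ₗ[ℂ] B} {n : ℕ} {q : 𝒜}

theorem IsLieDerivation.perturbation_iterLie_two_mul (hL : IsLieDerivation (n + 1) L) (a : 𝒜)
    {l : List 𝒜} (hl : l.length = 2 * n) :
    perturbation L (iterLie a l) = iterLie (perturbation L a) (l.map (perturbation L)) := by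
  rw [← l.take_append_drop n, List.map_append, iterLie_append, iterLie_append,
    hL.perturbation_iterLie _ (by simp only [List.length_drop]; omega),
    hL.perturbation_iterLie _ (by simp only [List.length_take]; omega)]

theorem IsLieDerivation.map_lie_lie (hn : 2 ≤ n) (hL : IsLieDerivation n L) (hq : q * q = q)
    {c : ℂ} (hc : L q = c • (1 : B)) (a b : 𝒜) :
    L ⁅⁅a, q⁆, b⁆ = ⁅⁅L a, (q : B)⁆, (b : B)⁆ + ⁅⁅(a : B), (q : B)⁆, L b⁆ := by
  obtain ⟨n, rfl⟩ := Nat.exists_eq_add_of_le' hn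
  have hφq (x : B[ε]) : ⁅x, perturbation L q⁆ = ⁅x, inl (q : B)⁆ := by
    ext
    · rfl
    · rw [snd_lie, snd_lie, snd_perturbation, hc, lie_smul_one, snd_inl, lie_zero]
      rfl
  have hinl : (inl (q : B) * inl (q : B) : B[ε]) = inl (q : B) := by
    rw [← inl_mul]
    exact congrArg inl (congrArg Subtype.val hq)
  have h := hL.perturbation_iterLie_two_mul a (l := List.replicate (2 * n + 1) q ++ [b])
    (by simp only [List.length_append, List.length_replicate, List.length_singleton]; omega)
  rw [iterLie_append, List.map_append, iterLie_append, List.map_replicate,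
    iterLie_replicate_of_lie_lie_lie (lie_lie_lie_idempotent hq),
    iterLie_replicate_of_lie_lie_lie (x := perturbation L q) fun w => by
      simp only [hφq, lie_lie_lie_idempotent hinl]] at h
  have h' := congrArg snd h
  simp only [iterLie_cons, iterLie_nil, List.map_cons, List.map_nil, snd_lie, fst_lie,
    fst_perturbation, snd_perturbation, hc, lie_smul_one, add_zero] at h'
  exact h'

theorem IsLieDerivation.map_lie_lie_self (hn : 2 ≤ n) (hL : IsLieDerivation n L) (hq : q * q = q)
    {c : ℂ} (hc : L q = c • (1 : B)) (a : 𝒜) : L ⁅⁅a, q⁆, q⁆ = ⁅⁅L a, (q : B)⁆, (q : B)⁆ := by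
  rw [hL.map_lie_lie hn hq hc, hc, lie_smul_one, add_zero]

theorem IsLieDerivation.map_eq_mul_add_mul (hn : 2 ≤ n) (hL : IsLieDerivation n L)
    (hq : q * q = q) {c : ℂ} (hc : L q = c • (1 : B)) {S : 𝒜} (hqS : q * S = S) (hSq : S * q = 0) :
    L S = L S * q + q * L S := by
  have hqB : (q : B) * q = q := congrArg Subtype.val hq
  have hS : ⁅⁅S, q⁆, q⁆ = S := by
    simp only [Ring.lie_def, hqS, hSq, zero_sub, neg_mul, mul_neg, sub_neg_eq_add, neg_zero,
      zero_add]
  have h := hL.map_lie_lie_self hn hq hc S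
  have hq0 := idempotent_mul_lie_lie_mul_idempotent hqB (L S)
  rw [← h, hS] at hq0
  rwa [hS, lie_lie_idempotent hqB, hq0, mul_zero, sub_zero] at h

theorem IsLieDerivation.map_mul_self_eq_zero (hn : 2 ≤ n) (hL : IsLieDerivation n L)
    (hq : q * q = q) {c : ℂ} (hc : L q = c • (1 : B)) {S : 𝒜} (hqS : q * S = S) (hSq : S * q = 0) :
    L S * S = 0 := by
  have hqS' : (q : B) * S = S := congrArg Subtype.val hqS
  have hSq' : (S : B) * q = 0 := congrArg Subtype.val hSq
  have hW := hL.map_eq_mul_add_mul hn hq hc hqS hSq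
  have hSS : ⁅⁅S, q⁆, S⁆ = 0 := by
    rw [Ring.lie_def S q, hqS, hSq, zero_sub, neg_lie, lie_self, neg_zero]
  have h := hL.map_lie_lie hn hq hc S S
  rw [hSS, map_zero] at h
  set W := L S
  have hqWS : q * W * S = 0 := by
    have := congrArg (· * (S : B)) hW
    simpa [add_mul, mul_assoc, hqS'] using this
  have hSW : S * W = S * W * q := by
    have := congrArg ((S : B) * ·) hW
    simpa [mul_add, ← mul_assoc, hSq'] using this
  have hcomm : (2 : ℂ) • (W * S - S * W) = 0 := by
    calc (2 : ℂ) • (W * S - S * W) = W * (q * S) - q * W * S - S * W * q + S * q * W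
          + (S * q - q * S) * W - W * (S * q - q * S) := by
          rw [hqS', hqWS, hSq', ← hSW, two_smul]
          noncomm_ring
      _ = 0 := by
          rw [h]
          simp only [Ring.lie_def]
          noncomm_ring
  rw [smul_eq_zero_iff_right two_ne_zero, sub_eq_zero] at hcomm
  calc W * S = q * (W * S) := by rw [hcomm, ← mul_assoc, hqS']
    _ = 0 := by rw [← mul_assoc, hqWS]

/-- The inner derivation `a ↦ [g, a]` from `𝒜` to `B`. -/
def innerDerivation (𝒜 : Subalgebra ℂ B) (g : B) : 𝒜 →ₗ[ℂ] B :=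
  (LieModule.toEnd ℂ B B g).comp 𝒜.val.toLinearMap

theorem innerDerivation_apply (g : B) (a : 𝒜) : innerDerivation 𝒜 g a = ⁅g, (a : B)⁆ := rfl

theorem isDerivation_innerDerivation (g : B) : IsDerivation (innerDerivation 𝒜 g) := fun a b =>
  lie_mul g a b

theorem iterLie_replicate_of_lie_eq {R : Type*} [Ring R] {a x : R} (h : ⁅a, x⁆ = a) (k : ℕ) :
    iterLie a (List.replicate k x) = a := by
  induction k with
  | zero => rfl
  | succ k ih => rw [List.replicate_succ, iterLie_cons, h, ih]

theorem lie_lie_eq_of_lie_eq_zero {R : Type*} [Ring R] {a d q : R} (ha : ⁅a, q⁆ = a)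
    (hd : ⁅d, q⁆ = 0) : ⁅⁅a, d⁆, q⁆ = ⁅a, d⁆ := by
  rw [lie_lie, hd, lie_zero, ha, zero_sub, lie_skew]

theorem iterLie_replicate_dualNumber {R : Type*} [Ring R] {ξ x : R[ε]}
    (hξ : ⁅fst ξ, fst x⁆ = fst ξ) (hx : ⁅snd x, fst x⁆ = 0) (k : ℕ) :
    iterLie ξ (List.replicate k x) =
      inl (fst ξ) + inr (iterLie (snd ξ) (List.replicate k (fst x)) + k • ⁅fst ξ, snd x⁆) := by
  induction k with
  | zero => ext <;> simp [iterLie_nil]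
  | succ k ih =>
    rw [List.replicate_succ', iterLie_append, ih, List.replicate_succ', iterLie_append,
      iterLie_cons, iterLie_cons, iterLie_nil, iterLie_nil]
    ext
    · simp [fst_lie, hξ]
    · simp only [snd_lie, snd_add, fst_inl, snd_inl, fst_inr, snd_inr, zero_add, add_zero,
        zero_lie, add_lie, nsmul_lie, lie_lie_eq_of_lie_eq_zero hξ hx, succ_nsmul]
      abel

theorem IsLieDerivation.lie_map_idempotent_eq_zero (hn : 2 ≤ n) (hL : IsLieDerivation n L)
    (hq : q * q = q) (hLq : ⁅L q, (q : B)⁆ = 0) {U : 𝒜} (hU : ⁅U, q⁆ = U) :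
    ⁅(U : B), L q⁆ = 0 := by
  obtain ⟨n, rfl⟩ := Nat.exists_eq_add_of_le' (one_le_two.trans hn)
  have hUq : ⁅(U : B), (q : B)⁆ = U := congrArg Subtype.val hU
  have hqB : (q : B) * q = q := congrArg Subtype.val hq
  have hU' := hL.perturbation_iterLie_two_mul U (List.length_replicate (n := 2 * n) (a := q))
  rw [iterLie_replicate_of_lie_eq hU, List.map_replicate,
    iterLie_replicate_dualNumber hUq hLq] at hU'
  have hLU : L U = iterLie (L U) (List.replicate (2 * n) (q : B)) + (2 * n) • ⁅(U : B), L q⁆ := by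
    simpa [fst_perturbation, snd_perturbation] using congrArg snd hU'
  have hodd : ⁅iterLie (L U) (List.replicate (2 * n) (q : B)), (q : B)⁆ = ⁅L U, (q : B)⁆ := by
    rw [← iterLie_replicate_of_lie_lie_lie (lie_lie_lie_idempotent hqB) (L U) n,
      List.replicate_succ', iterLie_append]
    rfl
  have h0 : (2 * n) • ⁅(U : B), L q⁆ = 0 := by
    have := congrArg (fun w => ⁅w, (q : B)⁆) hLU
    simpa only [add_lie, nsmul_lie, hodd, lie_lie_eq_of_lie_eq_zero hUq hLq, left_eq_add] using this
  rw [← Nat.cast_smul_eq_nsmul ℂ] at h0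
  refine (smul_eq_zero_iff_right ?_).1 h0
  exact_mod_cast (by omega : 2 * n ≠ 0)

end Idempotent

section RankOne

variable {V : Type*} [AddCommGroup V] [Module ℂ V] {𝒜 : Subalgebra ℂ (Module.End ℂ V)}
  {f : V →ₗ[ℂ] ℂ} {e : V} {n : ℕ}

/-- The rank-one operator `v ↦ f v • u`, as a linear function of `u` with values in an algebra
containing all these operators. -/
def rankOne (h𝒜 : ∀ u, f.smulRight u ∈ 𝒜) : V →ₗ[ℂ] 𝒜 where
  toFun u := ⟨f.smulRight u, h𝒜 u⟩
  map_add' u v := Subtype.ext (LinearMap.ext fun w => smul_add (f w) u v)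
  map_smul' c u := Subtype.ext (LinearMap.ext fun w => smul_comm (f w) c u)

variable (h𝒜 : ∀ u, f.smulRight u ∈ 𝒜)

theorem rankOne_apply (u v : V) : (rankOne h𝒜 u : Module.End ℂ V) v = f v • u := rfl

theorem coe_mul_rankOne (a : 𝒜) (u : V) : a * rankOne h𝒜 u = rankOne h𝒜 ((a : Module.End ℂ V) u) :=
  Subtype.ext (LinearMap.ext fun v => map_smul (a : Module.End ℂ V) (f v) u)

theorem rankOne_mul_rankOne (u v : V) : rankOne h𝒜 u * rankOne h𝒜 v = f v • rankOne h𝒜 u := by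
  rw [coe_mul_rankOne, rankOne_apply, map_smul]

theorem lie_rankOne (u v : V) : ⁅rankOne h𝒜 u, rankOne h𝒜 v⁆ = rankOne h𝒜 (f v • u - f u • v) := by
  rw [Ring.lie_def, rankOne_mul_rankOne, rankOne_mul_rankOne, map_sub, map_smul, map_smul]

theorem rankOne_mul_self (he : f e = 1) : rankOne h𝒜 e * rankOne h𝒜 e = rankOne h𝒜 e := by
  rw [rankOne_mul_rankOne, he, one_smul]

theorem lie_rankOne_ker (he : f e = 1) {u : V} (hu : f u = 0) :
    ⁅rankOne h𝒜 u, rankOne h𝒜 e⁆ = rankOne h𝒜 u := by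
  rw [lie_rankOne, he, hu, one_smul, zero_smul, sub_zero]

theorem scalar_of_lie_rankOne_eq_zero (he : f e = 1) {w : Module.End ℂ V}
    (hw : ⁅w, (rankOne h𝒜 e : Module.End ℂ V)⁆ = 0)
    (hw' : ∀ u, f u = 0 → ⁅w, (rankOne h𝒜 u : Module.End ℂ V)⁆ = 0) :
    ∃ c : ℂ, w = c • (1 : Module.End ℂ V) := by
  refine ⟨f (w e), LinearMap.ext fun v => ?_⟩
  have hv : ⁅w, (rankOne h𝒜 v : Module.End ℂ V)⁆ = 0 := by
    have hdec : rankOne h𝒜 v = rankOne h𝒜 (v - f v • e) + f v • rankOne h𝒜 e := by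
      rw [map_sub, map_smul, sub_add_cancel]
    have := hw' (v - f v • e) (by simp [he])
    rw [hdec, Subalgebra.coe_add, Subalgebra.coe_smul, lie_add, this, lie_smul, hw, smul_zero,
      add_zero]
  have := LinearMap.congr_fun hv e
  simpa [Ring.lie_def, rankOne_apply, he, sub_eq_zero] using this

theorem IsLieDerivation.map_rankOne_scalar (hn : 2 ≤ n) {L : 𝒜 →ₗ[ℂ] Module.End ℂ V}
    (hL : IsLieDerivation n L) (he : f e = 1)
    (hLe : ⁅L (rankOne h𝒜 e), (rankOne h𝒜 e : Module.End ℂ V)⁆ = 0) :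
    ∃ c : ℂ, L (rankOne h𝒜 e) = c • (1 : Module.End ℂ V) := by
  refine scalar_of_lie_rankOne_eq_zero h𝒜 he hLe fun u hu => ?_
  rw [← lie_skew, hL.lie_map_idempotent_eq_zero hn (rankOne_mul_self h𝒜 he) hLe
    (lie_rankOne_ker h𝒜 he hu), neg_zero]

section Normalized

variable {K : 𝒜 →ₗ[ℂ] Module.End ℂ V} {c : ℂ} (hn : 2 ≤ n) (hK : IsLieDerivation n K) (he : f e = 1)
  (hq : K (rankOne h𝒜 e) = c • 1)
include hn hK he hq

theorem apply_map_rankOne_eq_zero {u : V} (hu : f u = 0) : f (K (rankOne h𝒜 u) e) = 0 := by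
  have hqq := rankOne_mul_self h𝒜 he
  have h := idempotent_mul_lie_lie_mul_idempotent (congrArg Subtype.val hqq) (K (rankOne h𝒜 u))
  rw [← hK.map_lie_lie_self hn hqq hq, lie_rankOne_ker h𝒜 he hu, lie_rankOne_ker h𝒜 he hu] at h
  have he0 : e ≠ 0 := by
    rintro rfl
    simp at he
  simpa [rankOne_apply, he, he0] using LinearMap.congr_fun h e

variable (hKe : ∀ u, f u = 0 → K (rankOne h𝒜 u) e = 0)
include hKe

theorem map_rankOne_eq_zero {u : V} (hu : f u = 0) : K (rankOne h𝒜 u) = 0 := by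
  have hqq := rankOne_mul_self h𝒜 he
  have hUq := lie_rankOne_ker h𝒜 he hu
  set q := rankOne h𝒜 e
  set U := rankOne h𝒜 u
  set W := K U
  have hWq : W * q = 0 := LinearMap.ext fun v => by
    simp [q, rankOne_apply, W, U, hKe u hu]
  have hW : W = q * W := by
    have h := hK.map_lie_lie_self hn hqq hq U
    rwa [hUq, hUq, lie_lie_idempotent (congrArg Subtype.val hqq), mul_assoc, hWq, mul_zero,
      mul_zero, sub_zero, zero_add] at h
  have hWU : ⁅W, (U : Module.End ℂ V)⁆ = 0 := by
    have h := hK.map_lie_lie hn hqq hq U U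
    rw [← coe_lie, hUq, lie_self, map_zero, Ring.lie_def W, hWq, zero_sub, ← hW, neg_lie,
      ← lie_skew _ W, ← neg_add, ← two_smul ℂ, zero_eq_neg] at h
    exact (smul_eq_zero_iff_right two_ne_zero).1 h
  have hfW (v : V) : f (W v) • u = f v • W u := by
    have h := LinearMap.congr_fun hWU v
    rw [eq_comm, ← sub_eq_zero]
    simpa [Ring.lie_def, U, rankOne_apply] using h
  have hWu : W u = 0 := by
    simpa [he, W, U, hKe u hu] using (hfW e).symm
  refine LinearMap.ext fun v => ?_
  rcases eq_or_ne u 0 with rfl | hu0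
  · simp [W, U]
  · have hv := hfW v
    rw [hWu, smul_zero, smul_eq_zero_iff_left hu0] at hv
    rw [hW, Module.End.mul_apply, rankOne_apply, hv, zero_smul, LinearMap.zero_apply]

theorem map_lie_rankOne {u : V} (hu : f u = 0) (a : 𝒜) :
    K ⁅rankOne h𝒜 u, a⁆ = ⁅(rankOne h𝒜 u : Module.End ℂ V), K a⁆ := by
  have h := hK.map_lie_lie hn (rankOne_mul_self h𝒜 he) hq (rankOne h𝒜 u) a
  rwa [← coe_lie, lie_rankOne_ker h𝒜 he hu, map_rankOne_eq_zero h𝒜 hn hK he hq hKe hu, zero_lie,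
    zero_lie, zero_add] at h

theorem apply_map_apply_eq_zero {u : V} (hu : f u = 0) (a : 𝒜) : f (K a u) = 0 := by
  have hlie (T : Module.End ℂ V) :
      ⁅(rankOne h𝒜 u : Module.End ℂ V), ⁅(rankOne h𝒜 u : Module.End ℂ V), T⁆⁆ =
        (-2 * f (T u)) • (rankOne h𝒜 u : Module.End ℂ V) := LinearMap.ext fun v => by
    simp only [Ring.lie_def, LinearMap.sub_apply, Module.End.mul_apply, rankOne_apply, map_smul,
      map_sub, hu, zero_smul, map_zero, sub_zero, LinearMap.smul_apply]
    module
  have h : K ⁅rankOne h𝒜 u, ⁅rankOne h𝒜 u, a⁆⁆ = 0 := by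
    have : ⁅rankOne h𝒜 u, ⁅rankOne h𝒜 u, a⁆⁆ = (-2 * f ((a : Module.End ℂ V) u)) • rankOne h𝒜 u :=
      Subtype.ext (hlie a)
    rw [this, map_smul, map_rankOne_eq_zero h𝒜 hn hK he hq hKe hu, smul_zero]
  rw [map_lie_rankOne h𝒜 hn hK he hq hKe hu, map_lie_rankOne h𝒜 hn hK he hq hKe hu, hlie] at h
  rcases eq_or_ne u 0 with rfl | hu0
  · simp
  · simpa [rankOne_apply, he, hu0] using LinearMap.congr_fun h e

theorem map_eq_zero_of_range {S : 𝒜} (hqS : rankOne h𝒜 e * S = S)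
    (hSq : S * rankOne h𝒜 e = 0) : K S = 0 := by
  have hqq := rankOne_mul_self h𝒜 he
  have hV := hK.map_eq_mul_add_mul hn hqq hq hqS hSq
  have hVS := hK.map_mul_self_eq_zero hn hqq hq hqS hSq
  have hS (v : V) : (S : Module.End ℂ V) v = f ((S : Module.End ℂ V) v) • e :=
    LinearMap.congr_fun (congrArg Subtype.val hqS).symm v
  by_cases hS0 : ∀ v, f ((S : Module.End ℂ V) v) = 0
  · rw [show S = 0 from Subtype.ext (LinearMap.ext fun v => by
      rw [hS, hS0, zero_smul]; rfl), map_zero]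
  · obtain ⟨w, hw⟩ := not_forall.1 hS0
    have hVe : K S e = 0 := by
      have := LinearMap.congr_fun hVS w
      rw [Module.End.mul_apply, hS, map_smul, LinearMap.zero_apply] at this
      exact (smul_eq_zero_iff_right hw).1 this
    refine LinearMap.ext fun v => ?_
    have hv : f (v - f v • e) = 0 := by simp [he]
    calc K S v = K S (v - f v • e) := by rw [map_sub, map_smul, hVe, smul_zero, sub_zero]
      _ = f (v - f v • e) • K S e + f (K S (v - f v • e)) • e := by
          conv_lhs => rw [hV]
          rw [LinearMap.add_apply, Module.End.mul_apply, rankOne_apply, map_smul]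
          rfl
      _ = 0 := by
          rw [hv, apply_map_apply_eq_zero h𝒜 hn hK he hq hKe hv, zero_smul, zero_smul, add_zero]

theorem exists_eq_smul_one (a : 𝒜) : ∃ t : ℂ, K a = t • (1 : Module.End ℂ V) := by
  have hqq := rankOne_mul_self h𝒜 he
  set q := rankOne h𝒜 e
  set S := q * a - f ((a : Module.End ℂ V) e) • q
  have hKS : K S = 0 := by
    refine map_eq_zero_of_range h𝒜 hn hK he hq hKe (S := S) ?_ ?_
    · simp only [S, mul_sub, mul_smul_comm, ← mul_assoc, hqq, q]
    · rw [sub_mul, mul_assoc, smul_mul_assoc, hqq, coe_mul_rankOne, rankOne_mul_rankOne, sub_self]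
  refine scalar_of_lie_rankOne_eq_zero h𝒜 he ?_ fun u hu => ?_
  · have hlie : ⁅⁅a, q⁆, q⁆ =
        rankOne h𝒜 ((a : Module.End ℂ V) e - f ((a : Module.End ℂ V) e) • e) + S := by
      refine Subtype.ext (LinearMap.ext fun v => ?_)
      simp only [Ring.lie_def, AddSubgroupClass.coe_sub, MulMemClass.coe_mul, LinearMap.sub_apply,
        Module.End.mul_apply, rankOne_apply, map_smul, he, one_smul, map_sub,
        AddMemClass.coe_add, SetLike.val_smul, LinearMap.add_apply, LinearMap.smul_apply, q, S]
      module
    rw [← lie_lie_lie_idempotent (congrArg Subtype.val hqq), ← hK.map_lie_lie_self hn hqq hq, hlie,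
      map_add, hKS, map_rankOne_eq_zero h𝒜 hn hK he hq hKe (by simp [he]), add_zero, zero_lie]
  · have hlie : ⁅rankOne h𝒜 u, a⁆ = ⁅rankOne h𝒜 u, S⁆ + rankOne h𝒜
        (f ((a : Module.End ℂ V) u) • e + f ((a : Module.End ℂ V) e) • u -
          (a : Module.End ℂ V) u) := by
      refine Subtype.ext (LinearMap.ext fun v => ?_)
      simp only [Ring.lie_def, AddSubgroupClass.coe_sub, MulMemClass.coe_mul, LinearMap.sub_apply,
        Module.End.mul_apply, rankOne_apply, map_smul, map_sub, map_add, AddMemClass.coe_add,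
        SetLike.val_smul, LinearMap.add_apply, LinearMap.smul_apply, he, hu, zero_smul,
        smul_zero, sub_zero, S, q]
      module
    rw [← lie_skew, ← map_lie_rankOne h𝒜 hn hK he hq hKe hu, hlie, map_add,
      map_lie_rankOne h𝒜 hn hK he hq hKe hu, hKS,
      map_rankOne_eq_zero h𝒜 hn hK he hq hKe (by simp [he, hu]), lie_zero, add_zero, neg_zero]

end Normalized

theorem exists_eq_lie_add_smul_one_of_map (hn : 2 ≤ n) {L : 𝒜 →ₗ[ℂ] Module.End ℂ V}
    (hL : IsLieDerivation n L) (he : f e = 1) {c : ℂ} (hq : L (rankOne h𝒜 e) = c • 1) :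
    ∃ σ : Module.End ℂ V, ∀ a, ∃ t : ℂ, L a = ⁅σ, (a : Module.End ℂ V)⁆ + t • 1 := by
  set σ : Module.End ℂ V :=
    { toFun v := L (rankOne h𝒜 v) e - (c * f v) • e
      map_add' u v := by
        simp only [map_add, LinearMap.add_apply]
        module
      map_smul' t v := by
        simp only [map_smul, LinearMap.smul_apply, smul_eq_mul, RingHom.id_apply]
        module }
  have hσ (v : V) : σ v = L (rankOne h𝒜 v) e - (c * f v) • e := rfl
  have hσe : σ e = 0 := by simp [hσ, hq, he]
  have hσf {u : V} (hu : f u = 0) : σ u = L (rankOne h𝒜 u) e := by simp [hσ, hu]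
  have hfσ (v : V) : f (σ v) = 0 := by
    have hv : f (v - f v • e) = 0 := by simp [he]
    rw [← sub_add_cancel v (f v • e), map_add, map_smul, hσe, smul_zero, add_zero, hσf hv]
    exact apply_map_rankOne_eq_zero h𝒜 hn hL he hq hv
  have hK : IsLieDerivation n (L - innerDerivation 𝒜 σ) :=
    hL.sub (isDerivation_innerDerivation σ).isLieDerivation
  have hKq : (L - innerDerivation 𝒜 σ) (rankOne h𝒜 e) = c • 1 := by
    have : ⁅σ, (rankOne h𝒜 e : Module.End ℂ V)⁆ = 0 := LinearMap.ext fun v => by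
      simp [Ring.lie_def, rankOne_apply, hσe, hfσ]
    rw [LinearMap.sub_apply, hq, innerDerivation_apply, this, sub_zero]
  have hKe (u : V) (hu : f u = 0) : (L - innerDerivation 𝒜 σ) (rankOne h𝒜 u) e = 0 := by
    simp [innerDerivation_apply, Ring.lie_def, rankOne_apply, he, hσe, hσf hu]
  refine ⟨σ, fun a => ?_⟩
  obtain ⟨t, ht⟩ := exists_eq_smul_one h𝒜 hn hK he hKq hKe a
  exact ⟨t, by rw [← ht, LinearMap.sub_apply, innerDerivation_apply, add_sub_cancel]⟩

include h𝒜 in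
theorem exists_eq_lie_add_smul_one (hf : f ≠ 0) (hn : 2 ≤ n) {L : 𝒜 →ₗ[ℂ] Module.End ℂ V}
    (hL : IsLieDerivation n L) :
    ∃ σ : Module.End ℂ V, ∀ a, ∃ t : ℂ, L a = ⁅σ, (a : Module.End ℂ V)⁆ + t • 1 := by
  obtain ⟨e, he⟩ := LinearMap.surjective hf 1
  have hqB := congrArg Subtype.val (rankOne_mul_self h𝒜 he)
  set g := ⁅L (rankOne h𝒜 e), (rankOne h𝒜 e : Module.End ℂ V)⁆
  have hL' : IsLieDerivation n (L - innerDerivation 𝒜 g) :=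
    hL.sub (isDerivation_innerDerivation g).isLieDerivation
  obtain ⟨c, hc⟩ := hL'.map_rankOne_scalar h𝒜 hn he (by
    rw [LinearMap.sub_apply, innerDerivation_apply, sub_lie, lie_lie_lie_idempotent hqB, sub_self])
  obtain ⟨σ, hσ⟩ := exists_eq_lie_add_smul_one_of_map h𝒜 hn hL' he hc
  refine ⟨σ + g, fun a => ?_⟩
  obtain ⟨t, ht⟩ := hσ a
  refine ⟨t, ?_⟩
  rw [LinearMap.sub_apply, sub_eq_iff_eq_add, innerDerivation_apply] at ht
  rw [ht, add_lie]
  abel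

end RankOne

/-! ### Local forms -/

theorem IsLieDerivation.map {B B' : Type*} [Ring B] [Algebra ℂ B] [Ring B'] [Algebra ℂ B']
    {𝒜 : Subalgebra ℂ B} {n : ℕ} {L : 𝒜 →ₗ[ℂ] B} (hL : IsLieDerivation n L) (ι : B →ₐ[ℂ] B')
    (hι : Function.Injective ι) :
    IsLieDerivation n
      (ι.toLinearMap ∘ₗ L ∘ₗ (𝒜.equivMapOfInjective ι hι).symm.toLinearMap) := fun x => by
  set e := 𝒜.equivMapOfInjective ι hι
  have hx (i : Fin n) : (x i : B') = ι (e.symm (x i)) := by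
    rw [← Subalgebra.coe_equivMapOfInjective_apply 𝒜 ι hι, AlgEquiv.apply_symm_apply]
  calc ι (L (e.symm (p n x))) = ι (L (p n (e.symm ∘ x))) :=
        congrArg (fun a => ι (L a)) (map_p (e.symm : _ →+* 𝒜) n x)
    _ = ∑ k, ι (p n (Function.update (fun i => (e.symm (x i) : B)) k (L (e.symm (x k))))) := by
        rw [hL, map_sum]
        rfl
    _ = _ := Finset.sum_congr rfl fun k _ => by
        rw [← AlgHom.coe_toRingHom ι, map_p, Function.comp_update]
        simp only [hx, Function.comp_def]
        rfl

section LocalForm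

variable {X : Type*} [NormedAddCommGroup X] [NormedSpace ℂ X] {𝒜 : Subalgebra ℂ (X →L[ℂ] X)}
  {L : 𝒜 →ₗ[ℂ] (X →L[ℂ] X)}

/-- On the vectors of `M`, the map `L` is the sum of the commutator with `σ`, of `k` times the
inclusion of `𝒜` and of the scalar `χ`. The map `σ` need not be continuous, nor leave `M`
invariant. -/
def HasLocalForm (L : 𝒜 →ₗ[ℂ] (X →L[ℂ] X)) (M : Submodule ℂ X) (σ : X →ₗ[ℂ] X) (k : ℂ)
    (χ : 𝒜 →ₗ[ℂ] ℂ) : Prop :=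
  ∀ A : 𝒜, ∀ x ∈ M, L A x =
    σ ((A : X →L[ℂ] X) x) - (A : X →L[ℂ] X) (σ x) + k • (A : X →L[ℂ] X) x + χ A • x

theorem exists_linear_of_forall_apply_eq_smul {E : Type*} [AddCommGroup E] [Module ℂ E]
    {K : E →ₗ[ℂ] Module.End ℂ X} {M : Submodule ℂ X} (hM : M ≠ ⊥)
    (h : ∀ a, ∃ t : ℂ, ∀ x ∈ M, K a x = t • x) :
    ∃ χ : E →ₗ[ℂ] ℂ, ∀ a, ∀ x ∈ M, K a x = χ a • x := by
  obtain ⟨x₀, hx₀, hne⟩ := Submodule.exists_mem_ne_zero_of_ne_bot hM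
  obtain ⟨φ, hφ⟩ := SeparatingDual.exists_eq_one (R := ℂ) hne
  refine ⟨(φ : X →ₗ[ℂ] ℂ) ∘ₗ K.flip x₀, fun a x hx => ?_⟩
  obtain ⟨t, ht⟩ := h a
  simp [ht x hx, ht x₀ hx₀, hφ]

theorem exists_hasLocalForm {M : Submodule ℂ X} (hM : M ≠ ⊥) {σ : X →ₗ[ℂ] X} {k : ℂ}
    (h : ∀ A : 𝒜, ∃ t : ℂ, ∀ x ∈ M, L A x =
      σ ((A : X →L[ℂ] X) x) - (A : X →L[ℂ] X) (σ x) + k • (A : X →L[ℂ] X) x + t • x) :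
    ∃ χ, HasLocalForm L M σ k χ := by
  let toEnd : (X →L[ℂ] X) →ₗ[ℂ] Module.End ℂ X := ContinuousLinearMap.coeLM ℂ
  let adσ : Module.End ℂ X →ₗ[ℂ] Module.End ℂ X := LieModule.toEnd ℂ _ _ σ
  let K := toEnd ∘ₗ (L - k • 𝒜.val.toLinearMap) - adσ ∘ₗ toEnd ∘ₗ 𝒜.val.toLinearMap
  have hK (A : 𝒜) (x : X) : K A x = L A x - k • (A : X →L[ℂ] X) x -
      (σ ((A : X →L[ℂ] X) x) - (A : X →L[ℂ] X) (σ x)) := rfl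
  obtain ⟨χ, hχ⟩ := exists_linear_of_forall_apply_eq_smul (K := K) hM fun A => by
    obtain ⟨t, ht⟩ := h A
    refine ⟨t, fun x hx => ?_⟩
    rw [hK, ht x hx]
    abel
  refine ⟨χ, fun A x hx => ?_⟩
  rw [← hχ A x hx, hK]
  abel

theorem isDerivationModCentroid_of_hasLocalForm {k : ℂ} {χ : 𝒜 →ₗ[ℂ] ℂ}
    (h : Dense {y : X | ∃ M : Submodule ℂ X, (∀ A : 𝒜, ∀ x ∈ M, (A : X →L[ℂ] X) x ∈ M) ∧ y ∈ M ∧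
      ∃ σ, HasLocalForm L M σ k χ}) :
    IsDerivationModCentroid L := by
  let D := L - k • 𝒜.val.toLinearMap - χ.smulRight 1
  have hD (A : 𝒜) : L A = D A + k • (A : X →L[ℂ] X) + χ A • 1 := by
    change L A = L A - k • (A : X →L[ℂ] X) - χ A • 1 + k • (A : X →L[ℂ] X) + χ A • 1
    abel
  refine ⟨D, fun A B => ContinuousLinearMap.ext_on (h.mono Submodule.subset_span) ?_, k,
    fun A => ⟨χ A, hD A⟩⟩
  rintro y ⟨M, hM, hy, σ, hσ⟩
  have hDσ (C : 𝒜) {x : X} (hx : x ∈ M) :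
      D C x = σ ((C : X →L[ℂ] X) x) - (C : X →L[ℂ] X) (σ x) := by
    have := hσ C x hx
    rw [hD] at this
    exact add_right_cancel (add_right_cancel this)
  change D (A * B) y = D A ((B : X →L[ℂ] X) y) + (A : X →L[ℂ] X) (D B y)
  rw [hDσ _ hy, hDσ A (hM B y hy), hDσ B hy, map_sub]
  exact (sub_add_sub_cancel _ _ _).symm

theorem IsLieDerivation.isDerivationModCentroid_of_smulRight_mem {f : X →L[ℂ] ℂ} (hf : f ≠ 0)
    (h𝒜 : ∀ u, f.smulRight u ∈ 𝒜) {n : ℕ} (hn : 2 ≤ n) (hL : IsLieDerivation n L) :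
    IsDerivationModCentroid L := by
  let ι : (X →L[ℂ] X) →ₐ[ℂ] Module.End ℂ X :=
    { ContinuousLinearMap.toLinearMapRingHom with commutes' := fun _ => rfl }
  have hι : Function.Injective ι := ContinuousLinearMap.coe_injective
  let e := 𝒜.equivMapOfInjective ι hι
  have hf' : (f : X →ₗ[ℂ] ℂ) ≠ 0 := fun h => hf (ContinuousLinearMap.coe_injective h)
  obtain ⟨σ, hσ⟩ := exists_eq_lie_add_smul_one (𝒜 := 𝒜.map ι)
    (fun u => Subalgebra.mem_map.2 ⟨_, h𝒜 u, rfl⟩) hf' hn (hL.map ι hι)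
  obtain ⟨z, hz⟩ := exists_apply_eq_one hf
  have htop : (⊤ : Submodule ℂ X) ≠ ⊥ := fun h => by
    simp [(Submodule.mem_bot ℂ).1 (h ▸ Submodule.mem_top : z ∈ (⊥ : Submodule ℂ X))] at hz
  obtain ⟨χ, hχ⟩ := exists_hasLocalForm (L := L) (σ := σ) (k := 0) htop fun A => by
    obtain ⟨t, ht⟩ := hσ (e A)
    have hA : ι (L A) = ⁅σ, ι (A : X →L[ℂ] X)⁆ + t • 1 := by simpa [e] using ht
    refine ⟨t, fun x _ => ?_⟩
    rw [zero_smul, add_zero]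
    exact LinearMap.congr_fun hA x
  exact isDerivationModCentroid_of_hasLocalForm
    (dense_univ.mono fun y _ => ⟨⊤, fun _ _ _ => Submodule.mem_top, Submodule.mem_top, σ, hχ⟩)

end LocalForm

/-! ### Normalization modulo the operators of finite rank -/

section FiniteRank

variable {X : Type*} [NormedAddCommGroup X] [NormedSpace ℂ X]

variable (X) in
/-- The bounded operators of finite rank. -/
def finiteRank : Submodule ℂ (X →L[ℂ] X) :=
  (LinearMap.finiteRange ℂ X X).comap (ContinuousLinearMap.coeLM ℂ)

theorem mem_finiteRank_of_forall_mem {W : X →L[ℂ] X} {V : Submodule ℂ X} [FiniteDimensional ℂ V]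
    (h : ∀ v, W v ∈ V) : W ∈ finiteRank X :=
  isNoetherian_of_le (LinearMap.range_le_iff_comap.2 (Submodule.eq_top_iff'.2 h))

theorem smulRight_mem_finiteRank (f : X →L[ℂ] ℂ) (x : X) : f.smulRight x ∈ finiteRank X :=
  mem_finiteRank_of_forall_mem fun v =>
    Submodule.smul_mem _ (f v) (Submodule.mem_span_singleton_self x)

theorem lie_mem_finiteRank {W : X →L[ℂ] X} (hW : W ∈ finiteRank X) (S : X →L[ℂ] X) :
    ⁅W, S⁆ ∈ finiteRank X :=
  Submodule.sub_mem _ (LinearMap.HasNoetherianRange.comp_right hW (S : X →ₗ[ℂ] X))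
    (LinearMap.HasNoetherianRange.comp_left hW (S : X →ₗ[ℂ] X))

theorem lie_add_lie_mem_finiteRank {S T U W : X →L[ℂ] X} (hT : T ∈ finiteRank X)
    (h : U ∈ finiteRank X ∨ W ∈ finiteRank X) : ⁅S, T⁆ + ⁅U, W⁆ ∈ finiteRank X := by
  refine Submodule.add_mem _ ?_ (h.elim (lie_mem_finiteRank · W) fun hW => ?_)
  · rw [← lie_skew]
    exact Submodule.neg_mem _ (lie_mem_finiteRank hT S)
  · rw [← lie_skew]
    exact Submodule.neg_mem _ (lie_mem_finiteRank hW U)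

theorem one_notMem_finiteRank (h : ¬FiniteDimensional ℂ X) : (1 : X →L[ℂ] X) ∉ finiteRank X := by
  intro h1
  have : IsNoetherian ℂ (LinearMap.range (LinearMap.id : X →ₗ[ℂ] X)) := h1
  rw [LinearMap.range_id] at this
  exact h (Module.Finite.equiv (Submodule.topEquiv (R := ℂ) (M := X)))

theorem exists_functional_finiteRank (h : ¬FiniteDimensional ℂ X) :
    ∃ ψ : (X →L[ℂ] X) →ₗ[ℂ] ℂ, ψ 1 = 1 ∧ ∀ W ∈ finiteRank X, ψ W = 0 := by
  obtain ⟨ψ, h1, h2⟩ := Submodule.exists_le_ker_of_notMem (one_notMem_finiteRank h)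
  exact ⟨(ψ 1)⁻¹ • ψ, inv_mul_cancel₀ h1, fun W hW => by
    rw [LinearMap.smul_apply, LinearMap.mem_ker.1 (h2 hW), smul_zero]⟩

/-- The scalars in `RespectsCommutatorRelations` and in the values of `L` that can be seen modulo
the operators of finite rank are zero. -/
structure IsNormalizedModFiniteRank {𝒜 : Subalgebra ℂ (X →L[ℂ] X)} (L : 𝒜 →ₗ[ℂ] (X →L[ℂ] X)) :
    Prop where
  sum_eq_zero : ∀ (m : ℕ) (a b : Fin m → 𝒜), ∑ i, ⁅a i, b i⁆ = 0 →
    (∀ i, ⁅L (a i), (b i : X →L[ℂ] X)⁆ + ⁅(a i : X →L[ℂ] X), L (b i)⁆ ∈ finiteRank X) →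
    ∑ i, (⁅L (a i), (b i : X →L[ℂ] X)⁆ + ⁅(a i : X →L[ℂ] X), L (b i)⁆) = 0
  scalar_eq_zero : ∀ (a : 𝒜) (c : ℂ), L a - c • 1 ∈ finiteRank X → c = 0

theorem IsNormalizedModFiniteRank.sum_three_eq_zero {𝒜 : Subalgebra ℂ (X →L[ℂ] X)}
    {L : 𝒜 →ₗ[ℂ] (X →L[ℂ] X)} (hL : IsNormalizedModFiniteRank L) {a₁ a₂ a₃ b₁ b₂ b₃ : 𝒜}
    (h : ⁅a₁, b₁⁆ - ⁅a₂, b₂⁆ + ⁅a₃, b₃⁆ = 0) (hLb₁ : L b₁ ∈ finiteRank X)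
    (hb₁ : (b₁ : X →L[ℂ] X) ∈ finiteRank X) (ha₂ : (a₂ : X →L[ℂ] X) ∈ finiteRank X)
    (hb₂ : (b₂ : X →L[ℂ] X) ∈ finiteRank X) (ha₃ : (a₃ : X →L[ℂ] X) ∈ finiteRank X)
    (hb₃ : (b₃ : X →L[ℂ] X) ∈ finiteRank X) :
    ⁅L a₁, (b₁ : X →L[ℂ] X)⁆ + ⁅(a₁ : X →L[ℂ] X), L b₁⁆ -
      (⁅L a₂, (b₂ : X →L[ℂ] X)⁆ + ⁅(a₂ : X →L[ℂ] X), L b₂⁆) +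
      (⁅L a₃, (b₃ : X →L[ℂ] X)⁆ + ⁅(a₃ : X →L[ℂ] X), L b₃⁆) = 0 := by
  have hsum := hL.sum_eq_zero 3 ![a₁, -a₂, a₃] ![b₁, b₂, b₃]
    (by simpa [Fin.sum_univ_three, neg_lie, ← sub_eq_add_neg, -lie_skew] using h) fun i => by
      fin_cases i
      exacts [lie_add_lie_mem_finiteRank hb₁ (.inr hLb₁),
        lie_add_lie_mem_finiteRank hb₂ (.inl (Submodule.neg_mem _ ha₂)),
        lie_add_lie_mem_finiteRank hb₃ (.inl ha₃)]
  rw [Fin.sum_univ_three] at hsum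
  rw [← hsum]
  simp only [Matrix.cons_val, map_neg, NegMemClass.coe_neg, neg_lie]
  abel

theorem RespectsCommutatorRelations.exists_isNormalizedModFiniteRank
    {𝒜 : Subalgebra ℂ (X →L[ℂ] X)} {L : 𝒜 →ₗ[ℂ] (X →L[ℂ] X)}
    (hL : RespectsCommutatorRelations L) (hX : ¬FiniteDimensional ℂ X) :
    ∃ H : 𝒜 →ₗ[ℂ] (X →L[ℂ] X), (∀ a, ∃ c : ℂ, H a = c • (1 : X →L[ℂ] X)) ∧
      IsNormalizedModFiniteRank (L - H) := by
  obtain ⟨ψ, hψ1, hψ⟩ := exists_functional_finiteRank hX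
  have hψs (c : ℂ) : ψ (c • 1) = c := by rw [map_smul, hψ1, smul_eq_mul, mul_one]
  let H : 𝒜 →ₗ[ℂ] (X →L[ℂ] X) := (ψ ∘ₗ L).smulRight 1
  have hH (a : 𝒜) : H a = ψ (L a) • 1 := rfl
  have hscalar (a : 𝒜) : ∃ c : ℂ, H a = c • (1 : X →L[ℂ] X) := ⟨_, hH a⟩
  refine ⟨H, hscalar, fun m a b hab hfr => ?_, fun a c h => ?_⟩
  · obtain ⟨c, hc⟩ := hL.sub_scalar hscalar m a b hab
    have hc0 : c = 0 := by
      rw [← hψs c, ← hc]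
      exact hψ _ (Submodule.sum_mem _ fun i _ => hfr i)
    rw [hc, hc0, zero_smul]
  · have := hψ _ h
    rwa [map_sub, LinearMap.sub_apply, map_sub, hH, hψs, hψs, sub_self, zero_sub, neg_eq_zero]
      at this

theorem exists_sub_smul_one_mem_finiteRank {W : X →L[ℂ] X} {U : Submodule ℂ X}
    (hU : Dense (U : Set X)) {h : X →L[ℂ] ℂ} {u₀ x : X} (hu₀ : u₀ ∈ U) (hhu₀ : h u₀ = 1)
    (hW : ∀ y ∈ U, h y = 0 → ∃ c : ℂ, W y - c • y ∈ Submodule.span ℂ {x}) :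
    ∃ c : ℂ, W - c • 1 ∈ finiteRank X ∧
      ∀ v, h v = 0 → (W - c • 1) v ∈ Submodule.span ℂ {x} := by
  let ℓ := Submodule.span ℂ {x}
  let inclKer := (U ⊓ LinearMap.ker (h : X →ₗ[ℂ] ℂ)).subtype
  obtain ⟨c, hc⟩ := exists_eq_smul_of_forall_apply
      (F := ℓ.mkQ ∘ₗ (W : X →ₗ[ℂ] X) ∘ₗ inclKer) (G := ℓ.mkQ ∘ₗ inclKer) fun y => by
    obtain ⟨c, hc⟩ := hW y y.2.1 y.2.2
    exact ⟨c, (Submodule.Quotient.eq _).2 hc⟩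
  let P : X →L[ℂ] X := (W - c • 1) * (1 - h.smulRight u₀)
  have hP (v : X) : P v = (W - c • 1) (v - h v • u₀) := rfl
  have hPU : U ≤ ℓ.comap (P : X →ₗ[ℂ] X) := fun v hv =>
    (Submodule.Quotient.eq ℓ).1 (LinearMap.congr_fun hc
      ⟨v - h v • u₀, U.sub_mem hv (U.smul_mem _ hu₀), by simp [hhu₀]⟩)
  have hPX (v : X) : P v ∈ ℓ := by
    have hcl : IsClosed (ℓ.comap (P : X →ₗ[ℂ] X) : Set X) :=
      (Submodule.closed_of_finiteDimensional ℓ).preimage P.continuous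
    exact Submodule.topologicalClosure_minimal _ hPU hcl
      (Submodule.dense_iff_topologicalClosure_eq_top.1 hU ▸ Submodule.mem_top)
  refine ⟨c, ?_, fun v hv => ?_⟩
  · have : W - c • 1 = P + h.smulRight ((W - c • 1) u₀) := by
      ext v
      rw [add_apply, hP, map_sub, map_smul]
      exact (sub_add_cancel _ _).symm
    rw [this]
    exact Submodule.add_mem _ (mem_finiteRank_of_forall_mem hPX) (smulRight_mem_finiteRank _ _)
  · simpa [hP, hv] using hPX v

end FiniteRank

/-! ### Chains whose proper members span a dense subspace -/

theorem lie_smulRight_sub_lie_add_lie_eq_zero {X : Type*} [NormedAddCommGroup X] [NormedSpace ℂ X]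
    {f g : X →L[ℂ] ℂ} {A : X →L[ℂ] X} {x y : X} (hfAx : f (A x) = 0) (hgy : g y = 1) :
    ⁅A, f.smulRight x⁆ - ⁅g.smulRight (A x), f.smulRight y⁆ +
      ⁅g.smulRight x, (f.comp A).smulRight y⁆ = 0 := by
  simp only [Ring.lie_def, mul_smulRight, smulRight_mul]
  ext v
  simp [hfAx, hgy]

namespace IsClosedChain

variable {X : Type*} [NormedAddCommGroup X] [NormedSpace ℂ X] {𝒩 : Set (Submodule ℂ X)}
  (h𝒩 : IsClosedChain 𝒩) {L : nestAlg 𝒩 →ₗ[ℂ] (X →L[ℂ] X)} {M M' : Submodule ℂ X}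
  {f g : X →L[ℂ] ℂ}

/-- The rank-one operators `v ↦ f v • x` in `nestAlg 𝒩`, for a fixed functional `f` that
annihilates `M` and for `x ∈ M`. -/
noncomputable def rankOne (hM : M ∈ 𝒩) (hf : ∀ y ∈ M, f y = 0) : M →ₗ[ℂ] nestAlg 𝒩 where
  toFun x := ⟨f.smulRight (x : X), h𝒩.smulRight_mem hM hf x.2⟩
  map_add' x y := Subtype.ext <| ContinuousLinearMap.ext fun v => smul_add (f v) (x : X) y
  map_smul' c x := Subtype.ext <| ContinuousLinearMap.ext fun v => smul_comm (f v) c (x : X)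

theorem coe_rankOne (hM : M ∈ 𝒩) (hf : ∀ y ∈ M, f y = 0) (x : M) :
    (h𝒩.rankOne hM hf x : X →L[ℂ] X) = f.smulRight (x : X) := rfl

theorem rankOne_sub_smul (hM : M ∈ 𝒩) (hf : ∀ y ∈ M, f y = 0) (hM' : M' ∈ 𝒩)
    (hg : ∀ y ∈ M', g y = 0) (c : ℂ) (hfg : ∀ y ∈ M, (f - c • g) y = 0) (x : M)
    (hx : (x : X) ∈ M') :
    h𝒩.rankOne hM hfg x = h𝒩.rankOne hM hf x - c • h𝒩.rankOne hM' hg ⟨x, hx⟩ := by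
  refine Subtype.ext <| ContinuousLinearMap.ext fun v => ?_
  change (f v - c * g v) • (x : X) = f v • (x : X) - c • g v • (x : X)
  rw [sub_smul, mul_smul]

theorem exists_functionals_of_dense (h𝒩 : IsClosedChain 𝒩) (hd : Dense (properSpan 𝒩 : Set X))
    (hM : M ∈ 𝒩) (hMt : M ≠ ⊤) :
    ∃ M' ∈ 𝒩, M' ≠ ⊤ ∧ M ≤ M' ∧ ∃ f g : X →L[ℂ] ℂ, (∀ x ∈ M', f x = 0) ∧ (∀ x ∈ M, g x = 0) ∧
      ∃ y ∈ M', g y = 1 ∧ ∃ z, f z = 1 ∧ g z = 0 := by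
  obtain ⟨M', hM', hM't, hlt⟩ := h𝒩.exists_gt hd hM hMt
  obtain ⟨y, hyM', hyM⟩ := SetLike.exists_of_lt hlt
  obtain ⟨g, hg, hgy⟩ := NestLie.exists_annihilator (h𝒩.isClosed M hM) hyM
  obtain ⟨z, -, hz⟩ := SetLike.exists_of_lt hM't.lt_top
  obtain ⟨f, hf, hfz⟩ := NestLie.exists_annihilator (h𝒩.isClosed M' hM') hz
  exact ⟨M', hM', hM't, hlt.le, f, g, hf, hg, y, hyM', hgy, z - g z • y, by simp [hfz, hf y hyM'],
    by simp [hgy]⟩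

variable (hL : IsNormalizedModFiniteRank L)
include h𝒩 hL

theorem exists_map_rankOne_apply_sub_mem_span (hM : M ∈ 𝒩) (hMt : M ≠ ⊤)
    (hf : ∀ y ∈ M, f y = 0) (x : M) {u₀ y : X} (hu₀ : u₀ ∈ properSpan 𝒩) (hfu₀ : f u₀ = 1)
    (hy : y ∈ properSpan 𝒩) (hfy : f y = 0) :
    ∃ c : ℂ, L (h𝒩.rankOne hM hf x) y - c • y ∈ Submodule.span ℂ {(x : X)} := by
  obtain ⟨M₁, hM₁, hM₁t, hMM₁, hyM₁⟩ := h𝒩.exists_ge_mem hM hMt hy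
  obtain ⟨M₂, hM₂, hM₂t, hM₁₂, hu₀M₂⟩ := h𝒩.exists_ge_mem hM₁ hM₁t hu₀
  obtain ⟨z₀, -, hz₀⟩ := SetLike.exists_of_lt hM₂t.lt_top
  obtain ⟨g, hg, hgz₀⟩ := NestLie.exists_annihilator (h𝒩.isClosed M₂ hM₂) hz₀
  let T := h𝒩.rankOne hM hf x
  let S := h𝒩.rankOne hM₂ hg ⟨y, hM₁₂ hyM₁⟩
  have hT (v : X) : (T : X →L[ℂ] X) v = f v • (x : X) := rfl
  have hS (v : X) : (S : X →L[ℂ] X) v = g v • y := rfl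
  have hTS : ⁅T, S⁆ = 0 := Subtype.ext <| ContinuousLinearMap.ext fun v => by
    simp [coe_lie, lie_apply, hT, hS, hfy, hg x (hM₁₂ (hMM₁ x.2))]
  have hrel := hL.sum_eq_zero 1 ![T] ![S] (by simpa using hTS) fun i => by
    fin_cases i
    exact lie_add_lie_mem_finiteRank (smulRight_mem_finiteRank g y)
      (.inl (smulRight_mem_finiteRank f (x : X)))
  set v := z₀ - f z₀ • u₀
  have hfv : f v = 0 := by simp [v, hfu₀]
  have hgv : g v = 1 := by simp [v, hgz₀, hg u₀ hu₀M₂]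
  have hv := DFunLike.congr_fun hrel v
  simp only [Fin.sum_univ_one, Matrix.cons_val_zero, add_apply, zero_apply, lie_apply, hT, hS, hfv,
    hgv, zero_smul, one_smul, map_zero, sub_zero] at hv
  refine ⟨g (L T v), Submodule.mem_span_singleton.2 ⟨-f (L S v), ?_⟩⟩
  rw [neg_smul]
  exact neg_eq_of_add_eq_zero_left hv

variable (hd : Dense (properSpan 𝒩 : Set X))
include hd

theorem map_rankOne (hM : M ∈ 𝒩) (hMt : M ≠ ⊤) (hf : ∀ y ∈ M, f y = 0) (x : M) :
    L (h𝒩.rankOne hM hf x) ∈ finiteRank X ∧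
      ∀ v, f v = 0 → L (h𝒩.rankOne hM hf x) v ∈ Submodule.span ℂ {(x : X)} := by
  rcases eq_or_ne f 0 with rfl | hf0
  · have : h𝒩.rankOne hM hf x = 0 :=
      Subtype.ext <| ContinuousLinearMap.ext fun _ => zero_smul ℂ (x : X)
    rw [this, map_zero]
    exact ⟨Submodule.zero_mem _, fun _ _ => Submodule.zero_mem _⟩
  obtain ⟨u₀, hu₀, hfu₀⟩ := exists_mem_apply_eq_one hd hf0
  obtain ⟨c, hc, hspan⟩ := exists_sub_smul_one_mem_finiteRank hd hu₀ hfu₀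
    fun y hy hfy => h𝒩.exists_map_rankOne_apply_sub_mem_span hL hM hMt hf x hu₀ hfu₀ hy hfy
  obtain rfl := hL.scalar_eq_zero _ c hc
  rw [zero_smul, sub_zero] at hc hspan
  exact ⟨hc, hspan⟩

theorem exists_forall_map_rankOne_apply_eq_smul (hM : M ∈ 𝒩) (hMt : M ≠ ⊤)
    (hf : ∀ y ∈ M, f y = 0) {v : X} (hv : f v = 0) :
    ∃ t : ℂ, ∀ x : M, L (h𝒩.rankOne hM hf x) v = t • (x : X) := by
  obtain ⟨t, ht⟩ := exists_eq_smul_of_forall_apply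
      (F := (ContinuousLinearMap.apply ℂ X v).toLinearMap ∘ₗ L ∘ₗ h𝒩.rankOne hM hf)
      (G := M.subtype) fun x => by
    obtain ⟨t, ht⟩ := Submodule.mem_span_singleton.1 ((h𝒩.map_rankOne hL hd hM hMt hf x).2 v hv)
    exact ⟨t, ht.symm⟩
  exact ⟨t, LinearMap.congr_fun ht⟩

theorem exists_forall_map_rankOne_apply (hM : M ∈ 𝒩) (hM' : M' ∈ 𝒩) (hMt : M' ≠ ⊤) (hMM' : M ≤ M')
    (hf : ∀ y ∈ M', f y = 0) {z : X} (hfz : f z = 1) {σ : X →ₗ[ℂ] X}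
    (hσ : ∀ x : M', σ x = L (h𝒩.rankOne hM' hf x) z) (hg : ∀ y ∈ M, g y = 0) (v : X) :
    ∃ t : ℂ, ∀ x : M, L (h𝒩.rankOne hM hg x) v = g v • σ x + t • (x : X) := by
  -- The combinations of `f` and `g` that vanish at `v` exhaust the case `f v ≠ 0`.
  have hgv {v : X} (hfv : f v ≠ 0) :
      ∃ t : ℂ, ∀ x : M, L (h𝒩.rankOne hM hg x) v = g v • σ x + t • (x : X) := by
    obtain ⟨s, hs⟩ := h𝒩.exists_forall_map_rankOne_apply_eq_smul hL hd hM' hMt hf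
      (v := v - f v • z) (by simp [hfz])
    have hfM (x : M') : L (h𝒩.rankOne hM' hf x) v = f v • σ x + s • (x : X) := by
      rw [← sub_eq_iff_eq_add', hσ, ← hs, map_sub, map_smul]
    set c := g v / f v
    have hc : ∀ y ∈ M, (g - c • f) y = 0 := fun y hy => by simp [hg y hy, hf y (hMM' hy)]
    obtain ⟨t, ht⟩ := h𝒩.exists_forall_map_rankOne_apply_eq_smul hL hd hM
      (ne_top_of_le_ne_top hMt hMM') hc (v := v) (by simp [c, hfv])
    refine ⟨t + c * s, fun x => ?_⟩
    have hx := ht x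
    rw [h𝒩.rankOne_sub_smul hM hg hM' hf c hc x (hMM' x.2), map_sub, map_smul, sub_apply,
      smul_apply, hfM, sub_eq_iff_eq_add, smul_add, smul_smul, div_mul_cancel₀ _ hfv] at hx
    rw [hx]
    module
  rcases ne_or_eq (f v) 0 with hfv | hfv
  · exact hgv hfv
  obtain ⟨s, hs⟩ := hgv (v := v + z) (by simp [hfv, hfz])
  obtain ⟨t, ht⟩ := hgv (v := z) (by simp [hfz])
  refine ⟨s - t, fun x => ?_⟩
  rw [← add_sub_cancel_right v z, map_sub, hs, ht, map_sub]
  module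

theorem map_apply_eq (hM : M ∈ 𝒩) (hM' : M' ∈ 𝒩) (hM't : M' ≠ ⊤) (hMM' : M ≤ M')
    (hf : ∀ y ∈ M', f y = 0) (hg : ∀ y ∈ M, g y = 0) {A : nestAlg 𝒩}
    (hfA : ∀ y ∈ M', f.comp (A : X →L[ℂ] X) y = 0) {x Ax : M} (hAx : (Ax : X) = (A : X →L[ℂ] X) x)
    {y : M'} (hgy : g y = 1) {z : X} (hfz : f z = 1) (hgz : g z = 0) :
    L A x = f (L A z) • (x : X)
      - (A : X →L[ℂ] X) (L (h𝒩.rankOne hM' hf (Submodule.inclusion hMM' x)) z)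
      + L (h𝒩.rankOne hM' hf (Submodule.inclusion hMM' x)) ((A : X →L[ℂ] X) z)
      + (L (h𝒩.rankOne hM hg Ax) y - f (L (h𝒩.rankOne hM hg Ax) z) • (y : X)
        + g (L (h𝒩.rankOne hM' hf y) z) • (Ax : X))
      - (f ((A : X →L[ℂ] X) z) • L (h𝒩.rankOne hM hg x) y
        - f ((A : X →L[ℂ] X) (L (h𝒩.rankOne hM hg x) z)) • (y : X)
        + g (L (h𝒩.rankOne hM' hfA y) z) • (x : X)) := by
  have hfAx : f ((A : X →L[ℂ] X) x) = 0 := hf _ (hMM' (A.2 M hM x x.2))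
  have hsum := hL.sum_three_eq_zero
    (a₁ := A) (b₁ := h𝒩.rankOne hM' hf (Submodule.inclusion hMM' x))
    (a₂ := h𝒩.rankOne hM hg Ax) (b₂ := h𝒩.rankOne hM' hf y)
    (a₃ := h𝒩.rankOne hM hg x) (b₃ := h𝒩.rankOne hM' hfA y)
    (Subtype.ext (by
      simpa only [AddSubgroupClass.coe_sub, Subalgebra.coe_add, coe_lie, coe_rankOne, hAx,
        Submodule.coe_inclusion, ZeroMemClass.coe_zero] using
        lie_smulRight_sub_lie_add_lie_eq_zero hfAx hgy))
    (h𝒩.map_rankOne hL hd hM' hM't hf _).1 (smulRight_mem_finiteRank _ _)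
    (smulRight_mem_finiteRank _ _) (smulRight_mem_finiteRank _ _) (smulRight_mem_finiteRank _ _)
    (smulRight_mem_finiteRank _ _)
  have hz := DFunLike.congr_fun hsum z
  simp only [add_apply, sub_apply, zero_apply, lie_apply, coe_rankOne, map_smul, hfz, hgz,
    ContinuousLinearMap.smulRight_apply, ContinuousLinearMap.comp_apply, Submodule.coe_inclusion,
    zero_smul, one_smul, map_zero, sub_zero] at hz
  linear_combination (norm := module) hz

theorem exists_forall_apply_eq (hM : M ∈ 𝒩) (hMt : M ≠ ⊤) :
    ∃ (σ : X →ₗ[ℂ] X) (k : ℂ), ∀ A : nestAlg 𝒩, ∃ t : ℂ, ∀ x ∈ M, L A x =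
      σ ((A : X →L[ℂ] X) x) - (A : X →L[ℂ] X) (σ x) + k • (A : X →L[ℂ] X) x + t • x := by
  obtain ⟨M', hM', hM't, hMM', f, g, hf, hg, y, hyM', hgy, z, hfz, hgz⟩ :=
    h𝒩.exists_functionals_of_dense hd hM hMt
  obtain ⟨σ, hσ⟩ := LinearMap.exists_extend
    ((ContinuousLinearMap.apply ℂ X z).toLinearMap ∘ₗ L ∘ₗ h𝒩.rankOne hM' hf)
  replace hσ (x : M') : σ x = L (h𝒩.rankOne hM' hf x) z := LinearMap.congr_fun hσ x
  have hform {M₁ : Submodule ℂ X} (hM₁ : M₁ ∈ 𝒩) (hM₁M' : M₁ ≤ M') {h : X →L[ℂ] ℂ}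
      (hh : ∀ y ∈ M₁, h y = 0) (v : X) :=
    h𝒩.exists_forall_map_rankOne_apply hL hd hM₁ hM' hM't hM₁M' hf hfz hσ hh v
  obtain ⟨r, hr⟩ := hform hM hMM' hg y
  obtain ⟨q, hq⟩ := hform hM hMM' hg z
  refine ⟨σ, r + g (σ y), fun A => ?_⟩
  have hfA : ∀ y ∈ M', f.comp (A : X →L[ℂ] X) y = 0 := fun y hy => hf _ (A.2 M' hM' y hy)
  obtain ⟨p, hp⟩ := hform hM' le_rfl hf ((A : X →L[ℂ] X) z)
  obtain ⟨s, hs⟩ := hform hM' le_rfl hfA z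
  refine ⟨f (L A z) + p - f ((A : X →L[ℂ] X) z) * (r + g (σ y)) - s, fun x hx => ?_⟩
  have hAx : (A : X →L[ℂ] X) x ∈ M := A.2 M hM x hx
  have hfAx : f ((A : X →L[ℂ] X) x) = 0 := hf _ (hMM' hAx)
  rw [h𝒩.map_apply_eq hL hd hM hM' hM't hMM' hf hg hfA (x := ⟨x, hx⟩) (Ax := ⟨_, hAx⟩) rfl
    (y := ⟨y, hyM'⟩) hgy hfz hgz, ← hσ, ← hσ, hp, hr, hr, hq, hq, hs]
  simp only [Submodule.coe_inclusion, ContinuousLinearMap.comp_apply, map_add, map_smul, hgz, hgy,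
    hfAx, smul_eq_mul]
  module

end IsClosedChain

/-! ### Gluing the local forms -/

theorem eq_zero_of_smul_mul_add_eq_smul_one {A R : Type*} [Ring A] [Algebra ℂ A] [Ring R]
    [Algebra ℂ R] {ρ : A →ₐ[ℂ] R} {κ : ℂ} {ξ : A →ₗ[ℂ] ℂ}
    (h : ∀ a b, κ • (ρ a * ρ b) + ξ a • ρ b + ξ b • ρ a = ξ (a * b) • (1 : R)) {S T : A}
    (hSS : S * S = 0) (hTT : T * T = 0) (hTS : ρ T * ρ S ≠ 0) : κ = 0 ∧ ξ = 0 := by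
  have hS0 : ρ S ≠ 0 := right_ne_zero_of_mul hTS
  have hT0 : ρ T ≠ 0 := left_ne_zero_of_mul hTS
  have hsq {Q : A} (hQQ : Q * Q = 0) : ρ Q * ρ Q = 0 := by rw [← map_mul, hQQ, map_zero]
  have hξ {Q : A} (hQQ : Q * Q = 0) (hQ0 : ρ Q ≠ 0) : ξ Q = 0 := by
    have := h Q Q
    rw [hsq hQQ, hQQ, map_zero, smul_zero, zero_smul, zero_add, ← add_smul] at this
    exact add_self_eq_zero.1 ((smul_eq_zero_iff_left hQ0).1 this)
  have hscalar {r : R} (hr : ρ T * r = 0) {c : ℂ} (hc : r = c • 1) : c = 0 := by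
    rw [hc, mul_smul_comm, mul_one] at hr
    exact (smul_eq_zero_iff_left hT0).1 hr
  have hκ : κ = 0 := by
    have hTS' := h T S
    rw [hξ hSS hS0, hξ hTT hT0, zero_smul, zero_smul, add_zero, add_zero] at hTS'
    rw [hscalar (by rw [mul_smul_comm, ← mul_assoc, hsq hTT, zero_mul, smul_zero]) hTS',
      zero_smul] at hTS'
    exact (smul_eq_zero_iff_left hTS).1 hTS'
  refine ⟨hκ, LinearMap.ext fun a => ?_⟩
  have haT := h a T
  rw [hκ, hξ hTT hT0, zero_smul, zero_smul, zero_add, add_zero] at haT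
  rw [hscalar (by rw [mul_smul_comm, hsq hTT, smul_zero]) haT, zero_smul] at haT
  exact (smul_eq_zero_iff_left hT0).1 haT

namespace HasLocalForm

variable {X : Type*} [NormedAddCommGroup X] [NormedSpace ℂ X] {𝒜 : Subalgebra ℂ (X →L[ℂ] X)}
  {L L' : 𝒜 →ₗ[ℂ] (X →L[ℂ] X)} {M M' : Submodule ℂ X} {σ σ' : X →ₗ[ℂ] X} {k k' : ℂ}
  {χ χ' : 𝒜 →ₗ[ℂ] ℂ}

theorem mono (h : HasLocalForm L M σ k χ) (hMM' : M' ≤ M) : HasLocalForm L M' σ k χ :=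
  fun A x hx => h A x (hMM' hx)

theorem sub (h : HasLocalForm L M σ k χ) (h' : HasLocalForm L' M σ' k' χ') :
    HasLocalForm (L - L') M (σ - σ') (k - k') (χ - χ') := fun A x hx => by
  simp only [LinearMap.sub_apply, sub_apply, h A x hx, h' A x hx, map_sub]
  module

theorem smul_mul_apply (h : HasLocalForm 0 M σ k χ)
    (hM : ∀ A : 𝒜, ∀ x ∈ M, (A : X →L[ℂ] X) x ∈ M) (A B : 𝒜) {x : X} (hx : x ∈ M) :
    k • (A : X →L[ℂ] X) ((B : X →L[ℂ] X) x) + χ A • (B : X →L[ℂ] X) x +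
      χ B • (A : X →L[ℂ] X) x = χ (A * B) • x := by
  have hAB : 0 = σ ((A : X →L[ℂ] X) ((B : X →L[ℂ] X) x)) -
      (A : X →L[ℂ] X) ((B : X →L[ℂ] X) (σ x)) +
      k • (A : X →L[ℂ] X) ((B : X →L[ℂ] X) x) + χ (A * B) • x := h (A * B) x hx
  have hA := h A _ (hM B x hx)
  have hB := congrArg (A : X →L[ℂ] X) (h B x hx)
  simp only [LinearMap.zero_apply, zero_apply, map_add, map_sub, map_smul, map_zero] at hA hB
  linear_combination (norm := module) hAB - hA - hB

end HasLocalForm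

section GlobalForm

variable {X : Type*} [NormedAddCommGroup X] [NormedSpace ℂ X] {𝒩 : Set (Submodule ℂ X)}
  {L : nestAlg 𝒩 →ₗ[ℂ] (X →L[ℂ] X)} {M M₁ M₂ : Submodule ℂ X}

/-- The restriction of the operators in `nestAlg 𝒩` to a member of `𝒩`. -/
def restrictHom (hM : M ∈ 𝒩) : nestAlg 𝒩 →ₐ[ℂ] Module.End ℂ M where
  toFun A := ((A : X →L[ℂ] X) : X →ₗ[ℂ] X).restrict (A.2 M hM)
  map_one' := rfl
  map_mul' _ _ := rfl
  map_zero' := rfl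
  map_add' _ _ := rfl
  commutes' _ := rfl

namespace IsClosedChain

variable (h𝒩 : IsClosedChain 𝒩)
include h𝒩

theorem hasLocalForm_unique (hM₁ : M₁ ∈ 𝒩) (hM₂ : M₂ ∈ 𝒩) (hM : M ∈ 𝒩) (h0 : M₁ ≠ ⊥)
    (h12 : M₁ < M₂) (h2 : M₂ < M) {σ σ' : X →ₗ[ℂ] X} {k k' : ℂ} {χ χ' : nestAlg 𝒩 →ₗ[ℂ] ℂ}
    (h : HasLocalForm L M σ k χ) (h' : HasLocalForm L M σ' k' χ') : k = k' ∧ χ = χ' := by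
  obtain ⟨x, hx, hx0⟩ := Submodule.exists_mem_ne_zero_of_ne_bot h0
  obtain ⟨y, hy, hyM₁⟩ := SetLike.exists_of_lt h12
  obtain ⟨f, hf, hfy⟩ := NestLie.exists_annihilator (h𝒩.isClosed M₁ hM₁) hyM₁
  obtain ⟨u, hu, huM₂⟩ := SetLike.exists_of_lt h2
  obtain ⟨g, hg, hgu⟩ := NestLie.exists_annihilator (h𝒩.isClosed M₂ hM₂) huM₂
  let T := h𝒩.rankOne hM₁ hf ⟨x, hx⟩
  let S := h𝒩.rankOne hM₂ hg ⟨y, hy⟩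
  have hTT : T * T = 0 :=
    Subtype.ext <| ContinuousLinearMap.ext fun v => by simp [T, coe_rankOne, hf x hx]
  have hSS : S * S = 0 :=
    Subtype.ext <| ContinuousLinearMap.ext fun v => by simp [S, coe_rankOne, hg y hy]
  have hTS : restrictHom hM T * restrictHom hM S ≠ 0 := fun hTS => hx0 <| by
    have : f (g u • y) • x = 0 := congrArg Subtype.val (LinearMap.congr_fun hTS ⟨u, hu⟩)
    simpa [hgu, hfy] using this
  have hdiff := h.sub h'
  rw [sub_self] at hdiff
  obtain ⟨hk, hχ⟩ := eq_zero_of_smul_mul_add_eq_smul_one (ρ := restrictHom hM)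
    (fun A B => LinearMap.ext fun v =>
      Subtype.ext (hdiff.smul_mul_apply (fun C => C.2 M hM) A B v.2)) hSS hTT hTS
  exact ⟨sub_eq_zero.1 hk, sub_eq_zero.1 hχ⟩

theorem isDerivationModCentroid_of_isNormalizedModFiniteRank
    (hd : Dense (properSpan 𝒩 : Set X)) {N : Submodule ℂ X} (hN : N ∈ 𝒩) (hN0 : N ≠ ⊥)
    (hNt : N ≠ ⊤) (hL : IsNormalizedModFiniteRank L) : IsDerivationModCentroid L := by
  have hlocal {M : Submodule ℂ X} (hM : M ∈ 𝒩) (hNM : N ≤ M) (hMt : M ≠ ⊤) :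
      ∃ σ k χ, HasLocalForm L M σ k χ := by
    obtain ⟨σ, k, hσ⟩ := h𝒩.exists_forall_apply_eq hL hd hM hMt
    exact ⟨σ, k, exists_hasLocalForm (ne_bot_of_le_ne_bot hN0 hNM) hσ⟩
  obtain ⟨M₂, hM₂, hM₂t, hN₂⟩ := h𝒩.exists_gt hd hN hNt
  obtain ⟨M, hM, hMt, h₂⟩ := h𝒩.exists_gt hd hM₂ hM₂t
  obtain ⟨σ, k, χ, hσ⟩ := hlocal hM (hN₂.trans h₂).le hMt
  refine isDerivationModCentroid_of_hasLocalForm (k := k) (χ := χ) (hd.mono fun y hy => ?_)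
  obtain ⟨M', hM', hM't, hMM', hyM'⟩ := h𝒩.exists_ge_mem hM hMt hy
  obtain ⟨σ', k', χ', hσ'⟩ := hlocal hM' ((hN₂.trans h₂).le.trans hMM') hM't
  obtain ⟨rfl, rfl⟩ := h𝒩.hasLocalForm_unique hN hM₂ hM hN0 hN₂ h₂ hσ (hσ'.mono hMM')
  exact Set.mem_ofPred.2 ⟨M', fun A => A.2 M' hM', hyM', σ', hσ'⟩

theorem isDerivationModCentroid {N : Submodule ℂ X} (hN : N ∈ 𝒩) (hN0 : N ≠ ⊥) (hNt : N ≠ ⊤)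
    {n : ℕ} (hn : 2 ≤ n) (hL : IsLieDerivation n L) : IsDerivationModCentroid L := by
  rcases dense_properSpan_or_exists_smulRight_mem 𝒩 with hd | ⟨f, hf, hfu⟩
  · have hrel := hL.respectsCommutatorRelations (h𝒩.scalarOfLieScalar hN hN0 hNt) hn
    obtain ⟨H, hH, hLH⟩ :=
      hrel.exists_isNormalizedModFiniteRank (h𝒩.not_finiteDimensional hd hN hNt)
    exact (h𝒩.isDerivationModCentroid_of_isNormalizedModFiniteRank hd hN hN0 hNt
      hLH).of_sub_scalar hH
  · exact hL.isDerivationModCentroid_of_smulRight_mem hf hfu hn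

end IsClosedChain

theorem IsStandardForm.continuous {B : Type*} [NormedRing B] [NormedAlgebra ℂ B]
    {𝒜 : Subalgebra ℂ B} {n : ℕ} {L D H : 𝒜 →ₗ[ℂ] B} (h : IsStandardForm n L D H) {b : 𝒜}
    (hb : ∀ c : ℂ, (b : B) ≠ c • 1) (hL : Continuous L) : Continuous D ∧ Continuous H := by
  have hclosed : IsClosed (Submodule.span ℂ {(1 : B)} : Set B) :=
    Submodule.closed_of_finiteDimensional _
  obtain ⟨θ, hθ, hθb⟩ := exists_annihilator hclosed (y := (b : B)) fun hmem =>
    let ⟨c, hc⟩ := Submodule.mem_span_singleton.1 hmem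
    hb c hc.symm
  have hθ1 : θ 1 = 0 := hθ 1 (Submodule.mem_span_singleton_self 1)
  have hLD (a : 𝒜) : L a = D a + H a := LinearMap.congr_fun h.eq_add a
  choose c hc using h.scalar
  -- Apply `θ` to `D (a * b) = D a * b + a * D b`, where `D a = L a - c a • 1`.
  have hca (a : 𝒜) : c a = θ (L a * b + a * (L b - c b • 1) - L (a * b)) := by
    rw [hLD, hLD, hLD, h.derivation, hc, hc, hc, add_sub_cancel_right, add_mul, smul_mul_assoc,
      one_mul]
    simp only [map_sub, map_add, map_smul, hθ1, hθb, smul_eq_mul]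
    ring
  have hH : Continuous H := by
    have hH_eq : (H : 𝒜 → B) = fun a => θ (L a * b + a * (L b - c b • 1) - L (a * b)) • (1 : B) :=
      funext fun a => by rw [hc, ← hca]
    rw [hH_eq]
    fun_prop
  refine ⟨?_, hH⟩
  have hD_eq : D = L - H := by rw [h.eq_add, add_sub_cancel_right]
  rw [hD_eq]
  exact hL.sub hH

theorem IsClosedChain.exists_ne_smul_one (h𝒩 : IsClosedChain 𝒩) {N : Submodule ℂ X} (hN : N ∈ 𝒩)
    (hN0 : N ≠ ⊥) (hNt : N ≠ ⊤) : ∃ T : nestAlg 𝒩, ∀ c : ℂ, (T : X →L[ℂ] X) ≠ c • 1 := by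
  obtain ⟨T, hT, hT0, hTT⟩ := h𝒩.exists_sq_zero hN hN0 hNt
  refine ⟨⟨T, hT⟩, fun c hc => hT0 ?_⟩
  change T = c • 1 at hc
  have h1 : (1 : X →L[ℂ] X) ≠ 0 := right_ne_zero_of_smul (hc ▸ hT0)
  rw [hc, smul_mul_smul_comm, one_mul, smul_eq_zero_iff_left h1, mul_self_eq_zero] at hTT
  rw [hc, hTT, zero_smul]

end GlobalForm

end NestLie

theorem theorem3p1_general {X : Type*} [NormedAddCommGroup X] [NormedSpace ℂ X]
    {𝒩 : Set (Submodule ℂ X)} (h𝒩 : NestLie.IsClosedChain 𝒩) {N : Submodule ℂ X} (hN : N ∈ 𝒩)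
    (hN0 : N ≠ ⊥) (hNt : N ≠ ⊤) {n : ℕ} (hn : 2 ≤ n)
    (L : NestLie.nestAlg 𝒩 →ₗ[ℂ] (X →L[ℂ] X)) :
    (NestLie.IsLieDerivation n L ↔
      ∃ D H : NestLie.nestAlg 𝒩 →ₗ[ℂ] (X →L[ℂ] X), NestLie.IsStandardForm n L D H) ∧
    (Continuous L →
      ∀ D H : NestLie.nestAlg 𝒩 →ₗ[ℂ] (X →L[ℂ] X), NestLie.IsStandardForm n L D H →
        Continuous D ∧ Continuous H) := by
  obtain ⟨T, hT⟩ := h𝒩.exists_ne_smul_one hN hN0 hNt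
  refine ⟨⟨fun hL => ?_, fun ⟨D, H, h⟩ => h.isLieDerivation hn⟩, fun hL D H h =>
    h.continuous hT hL⟩
  exact hL.exists_isStandardForm (h𝒩.scalarOfLieScalar hN hN0 hNt) hn
    (h𝒩.isDerivationModCentroid hN hN0 hNt hn hL)

theorem theorem3p1 {X : Type*} [NormedAddCommGroup X] [NormedSpace ℂ X] [CompleteSpace X]
    (𝒩 : Set (Submodule ℂ X)) (h𝒩 : NestLie.IsNest 𝒩) (hnontriv : 𝒩 ≠ {⊥, ⊤})
    (n : ℕ) (hn : 2 ≤ n) (L : NestLie.nestAlg 𝒩 →ₗ[ℂ] (X →L[ℂ] X)) :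
    (NestLie.IsLieDerivation n L ↔
      ∃ D H : NestLie.nestAlg 𝒩 →ₗ[ℂ] (X →L[ℂ] X), NestLie.IsStandardForm n L D H) ∧
    (Continuous L →
      ∀ D H : NestLie.nestAlg 𝒩 →ₗ[ℂ] (X →L[ℂ] X), NestLie.IsStandardForm n L D H →
        Continuous D ∧ Continuous H) := by
  obtain ⟨N, hN, hN0, hNt⟩ := h𝒩.exists_ne_bot_ne_top hnontriv
  exact theorem3p1_general h𝒩.isClosedChain hN hN0 hNt hn L
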